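/- For a partition $\pi$ of $n$, let $\omega(\pi)$ be the number of ones of $\pi$, $\mu(\pi)$ the number of parts larger than $\omega(\pi)$, and $\lambda(\pi)$ the largest part. The crank of $\pi$ is $\lambda(\pi)$ if $\omega(\pi)=0$, and $\mu(\pi)-\omega(\pi)$ otherwise. Let $$M_\omega(m,j,n)=\sum_{\pi\vdash n,\ \mathrm{crank}(\pi)\equiv m\ (\mathrm{mod}\ j)}\omega(\pi)$$ (so that $M_\omega(m,j,0)=0$). Write $(a;q)_\infty=\prod_{n\ge 0}(1-aq^n)$ and $(a_1,\dots,a_k;q)_\infty=\prod_{i=1}^k (a_i;q)_\infty$, and put $$A(q)=\frac{(q^2,q^3,q^5;q^5)_\infty}{(q,q^4;q^5)_\infty^2},\quad B(q)=\frac{(q^5;q^5)_\infty}{(q,q^4;q^5)_\infty},\quad C(q)=\frac{(q^5;q^5)_\infty}{(q^2,q^3;q^5)_\infty},\quad D(q)=\frac{(q,q^4,q^5;q^5)_\infty}{(q^2,q^3;q^5)_\infty^2},$$ $$R_i(q)=\sum_{n\ge 1}\frac{q^{ni}}{1-q^{5n}}\ (1\le i\le 5),\qquad S(q)=\sum_{n\ge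 1}\frac{q^{n+1}}{1-q^{n+1}},\qquad T(q)=\frac{q}{5(1-q)(q;q)_\infty}.$$ Then the following identities of formal power series in $q$ hold: \begin{align*} \sum_{n\ge 0}M_\omega(0,5,n)q^n={}&\tfrac{q^3}{5}D(q^5)\bigl(-3R_1(q)+2R_2(q)+2R_3(q)-3R_4(q)+2R_5(q)-2S(q)\bigr)\\ &+\tfrac{q^2}{5}C(q^5)\bigl(-2R_1(q)+3R_2(q)+3R_3(q)-2R_4(q)-2R_5(q)+2S(q)\bigr)\\ &+\tfrac{q}{5}B(q^5)\bigl(4R_1(q)-R_2(q)-R_3(q)+4R_4(q)-6R_5(q)+6S(q)\bigr)\\ &+\tfrac{1}{5}A(q^5)\bigl(-R_1(q)-R_2(q)-R_3(q)-R_4(q)+4R_5(q)-4S(q)\bigr)+T(q),\\ \sum_{n\ge 0}M_\omega(1,5,n)q^n={}&\tfrac{q^3}{5}D(q^5)\bigl(2R_1(q)+2R_2(q)-3R_3(q)+2R_4(q)-3R_5(q)+3S(q)\bigr)\\ &+\tfrac{q^2}{5}C(q^5)\bigl(3R_1(q)+3R_2(q)-2R_3(q)-2R_4(q)-2R_5(q)+2S(q)\bigr)\\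 &+\tfrac{q}{5}B(q^5)\bigl(-R_1(q)-R_2(q)+4R_3(q)-6R_4(q)+4R_5(q)-4S(q)\bigr)\\ &+\tfrac{1}{5}A(q^5)\bigl(-R_1(q)-R_2(q)-R_3(q)+4R_4(q)-R_5(q)+S(q)\bigr)+T(q),\\ \sum_{n\ge 0}M_\omega(2,5,n)q^n={}&\tfrac{q^3}{5}D(q^5)\bigl(2R_1(q)-3R_2(q)+2R_3(q)-3R_4(q)+2R_5(q)-2S(q)\bigr)\\ &+\tfrac{q^2}{5}C(q^5)\bigl(3R_1(q)-2R_2(q)-2R_3(q)-2R_4(q)+3R_5(q)-3S(q)\bigr)\\ &+\tfrac{q}{5}B(q^5)\bigl(-R_1(q)+4R_2(q)-6R_3(q)+4R_4(q)-R_5(q)+S(q)\bigr)\\ &+\tfrac{1}{5}A(q^5)\bigl(-R_1(q)-R_2(q)+4R_3(q)-R_4(q)-R_5(q)+S(q)\bigr)+T(q),\\ \sum_{n\ge 0}M_\omega(3,5,n)q^n={}&\tfrac{q^3}{5}D(q^5)\bigl(-3R_1(q)+2R_2(q)-3R_3(q)+2R_4(q)+2R_5(q)-2S(q)\bigr)\\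 &+\tfrac{q^2}{5}C(q^5)\bigl(-2R_1(q)-2R_2(q)-2R_3(q)+3R_4(q)+3R_5(q)-3S(q)\bigr)\\ &+\tfrac{q}{5}B(q^5)\bigl(4R_1(q)-6R_2(q)+4R_3(q)-R_4(q)-R_5(q)+S(q)\bigr)\\ &+\tfrac{1}{5}A(q^5)\bigl(-R_1(q)+4R_2(q)-R_3(q)-R_4(q)-R_5(q)+S(q)\bigr)+T(q),\\ \sum_{n\ge 0}M_\omega(4,5,n)q^n={}&\tfrac{q^3}{5}D(q^5)\bigl(2R_1(q)-3R_2(q)+2R_3(q)+2R_4(q)-3R_5(q)+3S(q)\bigr)\\ &+\tfrac{q^2}{5}C(q^5)\bigl(-2R_1(q)-2R_2(q)+3R_3(q)+3R_4(q)-2R_5(q)+2S(q)\bigr)\\ &+\tfrac{q}{5}B(q^5)\bigl(-6R_1(q)+4R_2(q)-R_3(q)-R_4(q)+4R_5(q)-4S(q)\bigr)\\ &+\tfrac{1}{5}A(q^5)\bigl(4R_1(q)-R_2(q)-R_3(q)-R_4(q)-R_5(q)+S(q)\bigr)+T(q). \end{align*} -/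

import Mathlib

open PowerSeries

namespace OnesCrank

section Partitions

variable {n : ℕ}

/-- The number of ones `ω(π)` of a partition. -/
def omega (π : n.Partition) : ℕ := π.parts.count 1

/-- The number `μ(π)` of parts larger than the number of ones. -/
def mu (π : n.Partition) : ℕ := (π.parts.filter (fun i => omega π < i)).card

/-- The largest part `λ(π)` of a partition (`0` for the empty partition of `0`). -/
def largestPart (π : n.Partition) : ℕ := π.parts.sup

/-- The crank of a partition. -/
def crank (π : n.Partition) : ℤ :=
  if omega π = 0 then (largestPart π : ℤ) else (mu π : ℤ) - (omega π : ℤ)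

end Partitions

/-- `M_ω(m, j, n)`: the total number of ones in the partitions of `n` whose crank is congruent
to `m` modulo `j`. -/
def Mω (m : ℤ) (j n : ℕ) : ℕ :=
  ∑ π : n.Partition with crank π ≡ m [ZMOD (j : ℤ)], omega π

/-- The generating function `∑_{n ≥ 0} M_ω(m, j, n) q ^ n`, with `q = X`. -/
noncomputable def genMω (m : ℤ) (j : ℕ) : ℂ⟦X⟧ :=
  PowerSeries.mk fun n => (Mω m j n : ℂ)

section QSeries

/-! The `q`-series below are formal power series over `ℂ`. Each is written as a function of an
element `q : ℂ⟦X⟧` with zero constant coefficient, so that one can insert both `q = X` and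
`q = X ^ 5`. Infinite sums and products are limits for coefficientwise convergence (they do
converge, as proved below). The inverse is the one of formal power series; it is applied only to
series with nonzero constant coefficient. -/

open scoped PowerSeries.WithPiTopology

/-- `(a; q)_∞ = ∏_{n ≥ 0} (1 - a q ^ n)`. -/
noncomputable def qPoch (a q : ℂ⟦X⟧) : ℂ⟦X⟧ := ∏' n : ℕ, (1 - a * q ^ n)

/-- `A(q) = (q², q³, q⁵; q⁵)_∞ / (q, q⁴; q⁵)_∞²`. -/
noncomputable def serA (q : ℂ⟦X⟧) : ℂ⟦X⟧ :=
  qPoch (q ^ 2) (q ^ 5) * qPoch (q ^ 3) (q ^ 5) * qPoch (q ^ 5) (q ^ 5) *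
    ((qPoch q (q ^ 5) * qPoch (q ^ 4) (q ^ 5)) ^ 2)⁻¹

/-- `B(q) = (q⁵; q⁵)_∞ / (q, q⁴; q⁵)_∞`. -/
noncomputable def serB (q : ℂ⟦X⟧) : ℂ⟦X⟧ :=
  qPoch (q ^ 5) (q ^ 5) * (qPoch q (q ^ 5) * qPoch (q ^ 4) (q ^ 5))⁻¹

/-- `C(q) = (q⁵; q⁵)_∞ / (q², q³; q⁵)_∞`. -/
noncomputable def serC (q : ℂ⟦X⟧) : ℂ⟦X⟧ :=
  qPoch (q ^ 5) (q ^ 5) * (qPoch (q ^ 2) (q ^ 5) * qPoch (q ^ 3) (q ^ 5))⁻¹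

/-- `D(q) = (q, q⁴, q⁵; q⁵)_∞ / (q², q³; q⁵)_∞²`. -/
noncomputable def serD (q : ℂ⟦X⟧) : ℂ⟦X⟧ :=
  qPoch q (q ^ 5) * qPoch (q ^ 4) (q ^ 5) * qPoch (q ^ 5) (q ^ 5) *
    ((qPoch (q ^ 2) (q ^ 5) * qPoch (q ^ 3) (q ^ 5)) ^ 2)⁻¹

/-- `R_i(q) = ∑_{n ≥ 1} q ^ (n i) / (1 - q ^ (5 n))`; the index of summation is shifted by one. -/
noncomputable def serR (i : ℕ) (q : ℂ⟦X⟧) : ℂ⟦X⟧ :=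
  ∑' n : ℕ, q ^ ((n + 1) * i) * (1 - q ^ (5 * (n + 1)))⁻¹

/-- `S(q) = ∑_{n ≥ 1} q ^ (n + 1) / (1 - q ^ (n + 1))`; the index of summation is shifted by
one. -/
noncomputable def serS (q : ℂ⟦X⟧) : ℂ⟦X⟧ :=
  ∑' n : ℕ, q ^ (n + 2) * (1 - q ^ (n + 2))⁻¹

/-- `T(q) = q / (5 (1 - q) (q; q)_∞)`. -/
noncomputable def serT (q : ℂ⟦X⟧) : ℂ⟦X⟧ := q * (5 * (1 - q) * qPoch q q)⁻¹

/-! The infinite products and sums converge, and the constant coefficient of the products is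
nonzero. -/

theorem le_order_pow_mul {q : ℂ⟦X⟧} (hq : constantCoeff q = 0) (k : ℕ) (f : ℂ⟦X⟧) :
    (k : ℕ∞) ≤ (q ^ k * f).order := by
  have h1 : (k : ℕ∞) ≤ (q ^ k).order := le_order_pow_of_constantCoeff_eq_zero k hq
  exact (h1.trans le_self_add).trans (le_order_mul _ _)

theorem tendsto_order {f : ℕ → ℂ⟦X⟧} (h : ∀ n : ℕ, (n : ℕ∞) ≤ (f n).order) :
    Filter.Tendsto (fun n => (f n).order) Filter.atTop (nhds ⊤) := by
  refine ENat.tendsto_nhds_top_iff_natCast_lt.mpr fun n =>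
    Filter.eventually_atTop.mpr ⟨n + 1, fun m hm => lt_of_lt_of_le ?_ (h m)⟩
  exact_mod_cast hm

theorem multipliable_qPoch (a : ℂ⟦X⟧) {q : ℂ⟦X⟧} (hq : constantCoeff q = 0) :
    Multipliable fun n : ℕ => 1 - a * q ^ n := by
  simp_rw [sub_eq_add_neg]
  apply PowerSeries.WithPiTopology.multipliable_one_add_of_tendsto_order_atTop_nhds_top
  refine tendsto_order fun n => ?_
  rw [order_neg, mul_comm]
  exact le_order_pow_mul hq n a

theorem constantCoeff_qPoch {a q : ℂ⟦X⟧} (ha : constantCoeff a = 0) (hq : constantCoeff q = 0) :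
    constantCoeff (qPoch a q) = 1 := by
  rw [qPoch, (multipliable_qPoch a hq).map_tprod (constantCoeff (R := ℂ))
    (PowerSeries.WithPiTopology.continuous_constantCoeff ℂ)]
  simp [ha]

theorem summable_serR {i : ℕ} (hi : 1 ≤ i) {q : ℂ⟦X⟧} (hq : constantCoeff q = 0) :
    Summable fun n : ℕ => q ^ ((n + 1) * i) * (1 - q ^ (5 * (n + 1)))⁻¹ := by
  refine PowerSeries.WithPiTopology.summable_of_tendsto_order_atTop_nhds_top _
    (tendsto_order fun n => le_trans ?_ (le_order_pow_mul hq _ _))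
  exact_mod_cast (by nlinarith : n ≤ (n + 1) * i)

theorem summable_serS {q : ℂ⟦X⟧} (hq : constantCoeff q = 0) :
    Summable fun n : ℕ => q ^ (n + 2) * (1 - q ^ (n + 2))⁻¹ := by
  refine PowerSeries.WithPiTopology.summable_of_tendsto_order_atTop_nhds_top _
    (tendsto_order fun n => le_trans ?_ (le_order_pow_mul hq _ _))
  exact_mod_cast (by omega : n ≤ n + 2)

end QSeries

end OnesCrank

open OnesCrank

open OnesCrank

/-!
Let `P(z) = ∑_π ω(π) z ^ crank(π) q ^ |π|`. At a fifth root of unity `z`, `P(z)` is the sum of the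
series `z ^ m ∑_n M_ω(m, 5, n) q ^ n` over `m` modulo `5` (`onesCrankSeries_eq_sum`), so the five
generating functions are determined by the values of `P` at the five fifth roots of unity
(`eq_of_sum_root_pow_mul_eq`).

Sorting the partitions by their number `w` of ones gives
`P(z) = (1 - q) / (z q; q)_∞ ∑_w w (z q; q)_w / (q; q)_w (q / z) ^ w`. Without the weight `w` this
is a `q`-binomial series and so a product; the weight amounts to a logarithmic derivative, which
multiplies this product by a difference of Lambert series (`onesCrankSeries_eq`):
`P(z) = (q; q)_∞ / (z q, q / z; q)_∞ * (∑_{n ≥ 1} z⁻¹ q ^ n / (1 - z⁻¹ q ^ n) - S(q))`.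

If `z` is a fifth root of unity, the Lambert series is `∑ z ^ (-i) R_i(q)` (`lambert_eq`). If
moreover `z ≠ 1`, the product is dissected by `crankProduct_dissection` into multiples of `A(q⁵)`,
`q B(q⁵)`, `q² C(q⁵)` and `q³ D(q⁵)`. This rests on the Jacobi triple product (`hasSum_thetaTerm`): with
`P_z = (q, z q, q / z; q)_∞` one has `P_z P_{z²} = (q; q)_∞ (q⁵; q⁵)_∞`, hence the product equals
`P_z P_{z²}² / (q⁵; q⁵)_∞²`, and the theta series of `P_z` and `P_{z²}` only involve
exponents congruent to `0` or `1` modulo `5`. At `z = 1` the value is `P(1) = 5 T(q)`. It remains to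
expand (`dissection_mul_lambert`).
-/

open Filter Topology
open scoped PowerSeries.WithPiTopology

/-! ### Limits, products and sums of formal power series -/

theorem tendsto_zero_of_X_pow_dvd {f : ℕ → ℂ⟦X⟧} (h : ∀ n, X ^ n ∣ f n) :
    Tendsto f atTop (𝓝 0) := by
  rw [PowerSeries.WithPiTopology.tendsto_iff_coeff_tendsto]
  intro d
  refine tendsto_const_nhds.congr' ?_
  filter_upwards [eventually_gt_atTop d] with n hn
  rw [map_zero, PowerSeries.X_pow_dvd_iff.mp (h n) d hn]

theorem one_sub_mul_inv_cancel {f : ℂ⟦X⟧} (hf : constantCoeff f = 0) :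
    (1 - f) * (1 - f)⁻¹ = 1 :=
  PowerSeries.mul_inv_cancel _ (by simp [hf])

theorem inv_eq_of_mul_eq_one {f g : ℂ⟦X⟧} (h : f * g = 1) : f⁻¹ = g := by
  have h0 : constantCoeff f ≠ 0 := by
    intro h0
    have := congrArg (constantCoeff (R := ℂ)) h
    simp [h0] at this
  calc f⁻¹ = f⁻¹ * (f * g) := by rw [h, mul_one]
    _ = g := by rw [← mul_assoc, PowerSeries.inv_mul_cancel _ h0, one_mul]

theorem hasProd_qPoch (a : ℂ⟦X⟧) {q : ℂ⟦X⟧} (hq : constantCoeff q = 0) :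
    HasProd (fun n : ℕ => 1 - a * q ^ n) (qPoch a q) :=
  (multipliable_qPoch a hq).hasProd

/-- The reciprocal of `(a; q)_∞` is the product of the reciprocals of its factors. The
convergence of that product is proved directly, without continuity of inversion. -/
theorem hasProd_inv_qPoch {a q : ℂ⟦X⟧} (ha : constantCoeff a = 0) (hq : constantCoeff q = 0) :
    HasProd (fun n : ℕ => (1 - a * q ^ n)⁻¹) (qPoch a q)⁻¹ := by
  have hc : ∀ n : ℕ, constantCoeff (a * q ^ n) = 0 := fun n => by simp [ha]
  have hm : Multipliable fun n : ℕ => (1 - a * q ^ n)⁻¹ := by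
    have : (fun n : ℕ => (1 - a * q ^ n)⁻¹) =
        fun n : ℕ => 1 + a * q ^ n * (1 - a * q ^ n)⁻¹ := by
      funext n
      linear_combination one_sub_mul_inv_cancel (hc n)
    rw [this]
    apply PowerSeries.WithPiTopology.multipliable_one_add_of_tendsto_order_atTop_nhds_top
    refine tendsto_order fun n => ?_
    rw [mul_comm a, mul_assoc]
    exact le_order_pow_mul hq n _
  have h1 := (hasProd_qPoch a hq).mul hm.hasProd
  simp_rw [one_sub_mul_inv_cancel (hc _)] at h1
  rw [inv_eq_of_mul_eq_one (h1.unique hasProd_one)]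
  exact hm.hasProd

theorem qPoch_eq_one_sub_mul (a : ℂ⟦X⟧) {q : ℂ⟦X⟧} (hq : constantCoeff q = 0) :
    qPoch a q = (1 - a) * qPoch (a * q) q := by
  have h := multipliable_qPoch (a * q) hq
  have e : (fun n : ℕ => 1 - a * q * q ^ n) = fun n : ℕ => 1 - a * q ^ (n + 1) := by
    funext n; ring
  rw [e] at h
  have h1 := (h.hasProd.zero_mul).unique (hasProd_qPoch a hq)
  rw [← h1, qPoch, e, pow_zero, mul_one]

/-- Dominated convergence for sums of formal power series: a termwise limit of sums is the sum of
the limits, provided each coefficient involves only finitely many terms, uniformly in `n`. -/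
theorem hasSum_of_tendsto_of_coeff_eq_zero {ι : Type*} {f : ℕ → ι → ℂ⟦X⟧} {g : ι → ℂ⟦X⟧}
    {F : ℕ → ℂ⟦X⟧} {G : ℂ⟦X⟧} {s : ℕ → Finset ι}
    (hs : ∀ n d, ∀ i ∉ s d, coeff d (f n i) = 0)
    (hfg : ∀ i, Tendsto (fun n => f n i) atTop (𝓝 (g i)))
    (hF : ∀ n, HasSum (f n) (F n)) (hG : Tendsto F atTop (𝓝 G)) : HasSum g G := by
  rw [PowerSeries.WithPiTopology.hasSum_iff_hasSum_coeff]
  intro d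
  have hc : ∀ i, Tendsto (fun n => coeff d (f n i)) atTop (𝓝 (coeff d (g i))) := fun i =>
    (PowerSeries.WithPiTopology.tendsto_iff_coeff_tendsto _ _ _ _).mp (hfg i) d
  have hg : ∀ i ∉ s d, coeff d (g i) = 0 := fun i hi =>
    tendsto_nhds_unique (hc i) (by simp [hs _ d i hi])
  have h1 : Tendsto (fun n => coeff d (F n)) atTop (𝓝 (∑ i ∈ s d, coeff d (g i))) := by
    have h2 : ∀ n, coeff d (F n) = ∑ i ∈ s d, coeff d (f n i) := fun n =>
      ((PowerSeries.WithPiTopology.hasSum_iff_hasSum_coeff _).mp (hF n) d).unique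
        (hasSum_sum_of_ne_finset_zero (hs n d))
    simp_rw [h2]
    exact tendsto_finsetSum _ fun i _ => hc i
  rw [tendsto_nhds_unique
    ((PowerSeries.WithPiTopology.tendsto_iff_coeff_tendsto _ _ _ _).mp hG d) h1]
  exact hasSum_sum_of_ne_finset_zero hg

/-! ### The Jacobi triple product -/

/-- The triangular number `k (k + 1) / 2`, for an integer `k`. -/
def triangular (k : ℤ) : ℕ := (k * (k + 1) / 2).toNat

theorem two_mul_triangular (k : ℤ) : 2 * (triangular k : ℤ) = k * (k + 1) := by
  have h0 : 0 ≤ k * (k + 1) := by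
    rcases le_or_gt 0 k with h | h
    · positivity
    · nlinarith
  rw [triangular, Int.toNat_of_nonneg (by positivity)]
  exact Int.mul_ediv_cancel' (Int.even_mul_succ_self k).two_dvd

theorem triangular_sub_one_add (k : ℤ) : (triangular (k - 1) : ℤ) + k = triangular k := by
  have h1 := two_mul_triangular k
  have h2 := two_mul_triangular (k - 1)
  linarith [h1, h2, (by ring : (k - 1) * (k - 1 + 1) + 2 * k = k * (k + 1))]

/-- `1 / (q; q)_m`, extended by `0` to negative `m`. -/
noncomputable def invPochInt (q : ℂ⟦X⟧) (m : ℤ) : ℂ⟦X⟧ :=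
  if 0 ≤ m then ∏ j ∈ Finset.range m.toNat, (1 - q * q ^ j)⁻¹ else 0

/-- Also true for `m ≤ 0`: at `m = 0` the first factor vanishes, for `m < 0` both values of
`invPochInt` do. This is what makes the recursion of `centralGauss` hold without boundary terms. -/
theorem invPochInt_sub_one {q : ℂ⟦X⟧} (hq : constantCoeff q = 0) (m : ℤ) :
    invPochInt q (m - 1) = (1 - q ^ m.toNat) * invPochInt q m := by
  rcases lt_trichotomy m 0 with h | h | h
  · rw [invPochInt, invPochInt, if_neg (by omega), if_neg (by omega), mul_zero]
  · subst h
    simp [invPochInt]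
  · obtain ⟨n, rfl⟩ : ∃ n : ℕ, m = n + 1 := ⟨(m - 1).toNat, by omega⟩
    have e : ((n : ℤ) + 1).toNat = n + 1 := by omega
    rw [invPochInt, invPochInt, if_pos (by omega), if_pos (by omega), e, add_sub_cancel_right,
      Int.toNat_natCast, Finset.prod_range_succ, pow_succ']
    have h1 := one_sub_mul_inv_cancel (f := q * q ^ n) (by simp [hq])
    linear_combination -(∏ j ∈ Finset.range n, (1 - q * q ^ j)⁻¹) * h1

theorem tendsto_invPochInt {q : ℂ⟦X⟧} (hq : constantCoeff q = 0) :
    Tendsto (invPochInt q) atTop (𝓝 (qPoch q q)⁻¹) := by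
  have h1 := (hasProd_inv_qPoch hq hq).tendsto_prod_nat
  have h2 : Tendsto Int.toNat atTop atTop :=
    tendsto_atTop_atTop.mpr fun b => ⟨b, fun a ha => by omega⟩
  refine (h1.comp h2).congr' ?_
  filter_upwards [eventually_ge_atTop 0] with m hm
  simp [invPochInt, hm]

/-- The Gaussian binomial coefficient `[2n, n + k]_q`, which is `0` unless `|k| ≤ n`. -/
noncomputable def centralGauss (q : ℂ⟦X⟧) (n : ℕ) (k : ℤ) : ℂ⟦X⟧ :=
  (∏ j ∈ Finset.range (2 * n), (1 - q * q ^ j)) * (invPochInt q (n - k) * invPochInt q (n + k))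

theorem centralGauss_eq_zero (q : ℂ⟦X⟧) {n : ℕ} {k : ℤ} (h : ¬ (-n ≤ k ∧ k ≤ n)) :
    centralGauss q n k = 0 := by
  rw [centralGauss, invPochInt, invPochInt]
  by_cases h1 : k ≤ n
  · rw [if_neg (show ¬ (0 : ℤ) ≤ n + k by omega)]; simp
  · rw [if_neg (show ¬ (0 : ℤ) ≤ n - k by omega)]; simp

/-- Two steps of the Pascal recursion for Gaussian binomials at once: the recursion matched by
multiplication by `(1 + a q ^ n) (1 + b q ^ n)`, with `q = a b`. -/
theorem centralGauss_succ {q : ℂ⟦X⟧} (hq : constantCoeff q = 0) (n : ℕ) (k : ℤ) :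
    centralGauss q (n + 1) k = (1 + q ^ (2 * n + 1)) * centralGauss q n k +
      q ^ (n - (k - 1)).toNat * centralGauss q n (k - 1) +
      q ^ (n + (k + 1)).toNat * centralGauss q n (k + 1) := by
  by_cases hk : -(n + 1 : ℕ) ≤ k ∧ k ≤ (n + 1 : ℕ)
  swap
  · rw [centralGauss_eq_zero q hk, centralGauss_eq_zero q (by omega),
      centralGauss_eq_zero q (by omega), centralGauss_eq_zero q (by omega)]
    simp
  have e0 : 2 * (n + 1) = 2 * n + 1 + 1 := by ring
  obtain ⟨i, hi⟩ : ∃ i : ℕ, (n : ℤ) - k + 1 = i := ⟨((n : ℤ) - k + 1).toNat, by omega⟩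
  obtain ⟨j, hj⟩ : ∃ j : ℕ, (n : ℤ) + k + 1 = j := ⟨((n : ℤ) + k + 1).toNat, by omega⟩
  have e1 : ((n + 1 : ℕ) : ℤ) - k = i := by omega
  have e2 : ((n + 1 : ℕ) : ℤ) + k = j := by omega
  have e3 : (n : ℤ) - k = i - 1 := by omega
  have e4 : (n : ℤ) + k = j - 1 := by omega
  have e5 : (n : ℤ) - (k - 1) = i := by omega
  have e6 : (n : ℤ) + (k - 1) = j - 1 - 1 := by omega
  have e7 : (n : ℤ) - (k + 1) = i - 1 - 1 := by omega
  have e8 : (n : ℤ) + (k + 1) = j := by omega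
  simp only [centralGauss, e0, Finset.prod_range_succ, e1, e2, e3, e4, e5, e6, e7, e8,
    invPochInt_sub_one hq, Int.toNat_natCast]
  generalize ∏ j ∈ Finset.range (2 * n), (1 - q * q ^ j) = P
  have hij : i + j = 2 * n + 2 := by omega
  -- at the two ends one of the factors vanishes
  rcases Nat.eq_zero_or_pos i with rfl | hi0
  · obtain rfl : j = 2 * n + 2 := by omega
    have e9 : ((2 * n + 2 : ℕ) - 1 : ℤ).toNat = 2 * n + 1 := by omega
    rw [e9]
    ring
  rcases Nat.eq_zero_or_pos j with rfl | hj0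
  · obtain rfl : i = 2 * n + 2 := by omega
    have e9 : ((2 * n + 2 : ℕ) - 1 : ℤ).toNat = 2 * n + 1 := by omega
    rw [e9]
    ring
  obtain ⟨i, rfl⟩ : ∃ l, i = l + 1 := ⟨i - 1, by omega⟩
  obtain ⟨j, rfl⟩ : ∃ l, j = l + 1 := ⟨j - 1, by omega⟩
  have e9 : (((i + 1 : ℕ) : ℤ) - 1).toNat = i := by omega
  have e10 : (((j + 1 : ℕ) : ℤ) - 1).toNat = j := by omega
  rw [e9, e10, show 2 * n = i + j by omega]
  ring

/-- The summand `a ^ (k (k + 1) / 2) * b ^ (k (k - 1) / 2)` of Ramanujan's theta series `f(a, b)`.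
Writing `q = a b` instead of dividing by a variable keeps everything inside formal power series. -/
noncomputable def thetaTerm (a b : ℂ⟦X⟧) (k : ℤ) : ℂ⟦X⟧ :=
  a ^ triangular k * b ^ triangular (k - 1)

theorem mul_thetaTerm (a b : ℂ⟦X⟧) {n : ℕ} {k : ℤ} (hk : k ≤ n) :
    a * (a * b) ^ n * thetaTerm a b k = (a * b) ^ (n - k).toNat * thetaTerm a b (k + 1) := by
  have h1 := triangular_sub_one_add k
  have h2 := triangular_sub_one_add (k + 1)
  rw [add_sub_cancel_right] at h2
  have h3 : 1 + n + triangular k = (n - k).toNat + triangular (k + 1) := by omega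
  have h4 : n + triangular (k - 1) = (n - k).toNat + triangular k := by omega
  calc a * (a * b) ^ n * thetaTerm a b k
      = a ^ (1 + n + triangular k) * b ^ (n + triangular (k - 1)) := by rw [thetaTerm]; ring
    _ = _ := by rw [h3, h4, thetaTerm, add_sub_cancel_right]; ring

theorem mul_thetaTerm' (a b : ℂ⟦X⟧) {n : ℕ} {k : ℤ} (hk : -n ≤ k) :
    b * (a * b) ^ n * thetaTerm a b k = (a * b) ^ (n + k).toNat * thetaTerm a b (k - 1) := by
  have h1 := triangular_sub_one_add k
  have h2 := triangular_sub_one_add (k - 1)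
  have h3 : n + triangular k = (n + k).toNat + triangular (k - 1) := by omega
  have h4 : 1 + n + triangular (k - 1) = (n + k).toNat + triangular (k - 1 - 1) := by omega
  calc b * (a * b) ^ n * thetaTerm a b k
      = a ^ (n + triangular k) * b ^ (1 + n + triangular (k - 1)) := by rw [thetaTerm]; ring
    _ = _ := by rw [h3, h4, thetaTerm]; ring

theorem triangular_zero : triangular 0 = 0 := rfl

/-- The finite form of the Jacobi triple product identity. -/
theorem hasSum_centralGauss_mul {a b : ℂ⟦X⟧} (hq : constantCoeff (a * b) = 0) (n : ℕ) :
    HasSum (fun k : ℤ => centralGauss (a * b) n k * thetaTerm a b k)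
      (∏ j ∈ Finset.range n, (1 - -a * (a * b) ^ j) * (1 - -b * (a * b) ^ j)) := by
  induction n with
  | zero =>
    have h := hasSum_single (f := fun k : ℤ => centralGauss (a * b) 0 k * thetaTerm a b k) 0
      fun k hk => by rw [centralGauss_eq_zero _ (by omega), zero_mul]
    have e : triangular (-1) = 0 := rfl
    simpa [centralGauss, invPochInt, thetaTerm, triangular_zero, e] using h
  | succ n ih =>
    set q := a * b with hqdef
    have h1 := ih.mul_left (1 + q ^ (2 * n + 1))
    have h2 := ((Equiv.subRight (1 : ℤ)).hasSum_iff).mpr (ih.mul_left (a * q ^ n))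
    have h3 := ((Equiv.addRight (1 : ℤ)).hasSum_iff).mpr (ih.mul_left (b * q ^ n))
    have hF : (fun k : ℤ => centralGauss q (n + 1) k * thetaTerm a b k) = fun k =>
        (1 + q ^ (2 * n + 1)) * (centralGauss q n k * thetaTerm a b k) +
          a * q ^ n * (centralGauss q n (k - 1) * thetaTerm a b (k - 1)) +
          b * q ^ n * (centralGauss q n (k + 1) * thetaTerm a b (k + 1)) := by
      funext k
      rw [centralGauss_succ hq]
      have h4 : a * q ^ n * (centralGauss q n (k - 1) * thetaTerm a b (k - 1)) =
          q ^ (n - (k - 1)).toNat * centralGauss q n (k - 1) * thetaTerm a b k := by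
        by_cases hk : k - 1 ≤ n
        · have := mul_thetaTerm a b hk
          rw [sub_add_cancel, ← hqdef] at this
          linear_combination centralGauss q n (k - 1) * this
        · rw [centralGauss_eq_zero _ (by omega)]; ring
      have h5 : b * q ^ n * (centralGauss q n (k + 1) * thetaTerm a b (k + 1)) =
          q ^ (n + (k + 1)).toNat * centralGauss q n (k + 1) * thetaTerm a b k := by
        by_cases hk : -n ≤ k + 1
        · have := mul_thetaTerm' a b hk
          rw [add_sub_cancel_right, ← hqdef] at this
          linear_combination centralGauss q n (k + 1) * this
        · rw [centralGauss_eq_zero _ (by omega)]; ring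
      rw [h4, h5]
      ring
    have hP : ∏ j ∈ Finset.range (n + 1), (1 - -a * q ^ j) * (1 - -b * q ^ j) =
        (1 + q ^ (2 * n + 1)) * ∏ j ∈ Finset.range n, (1 - -a * q ^ j) * (1 - -b * q ^ j) +
          a * q ^ n * ∏ j ∈ Finset.range n, (1 - -a * q ^ j) * (1 - -b * q ^ j) +
          b * q ^ n * ∏ j ∈ Finset.range n, (1 - -a * q ^ j) * (1 - -b * q ^ j) := by
      rw [Finset.prod_range_succ]
      generalize ∏ j ∈ Finset.range n, (1 - -a * q ^ j) * (1 - -b * q ^ j) = P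
      rw [pow_succ q, pow_mul', pow_two, hqdef]
      ring
    rw [hF, hP]
    exact (h1.add h2).add h3

/-- `thetaTerm a b k` is divisible by `(a b) ^ (|k| (|k| - 1) / 2)`, so only finitely many terms
contribute to a given coefficient, even if `a` or `b` is a unit. -/
theorem coeff_thetaTerm_mul_eq_zero {a b : ℂ⟦X⟧} (hq : constantCoeff (a * b) = 0) (f : ℂ⟦X⟧)
    {d : ℕ} {k : ℤ} (hk : k ∉ Finset.Icc (-(d + 1) : ℤ) (d + 1)) :
    coeff d (f * thetaTerm a b k) = 0 := by
  have h1 := triangular_sub_one_add k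
  have h2 := two_mul_triangular k
  rw [Finset.mem_Icc] at hk
  have key : ∀ m : ℕ, d < m → ∀ g : ℂ⟦X⟧, coeff d ((a * b) ^ m * g) = 0 := fun m hm g =>
    coeff_of_lt_order _ (lt_of_lt_of_le (by exact_mod_cast hm) (le_order_pow_mul hq m g))
  rcases le_or_gt 0 k with h0 | h0
  · have h3 : d < triangular (k - 1) := by
      have : (d : ℤ) + 1 < k := by omega
      zify
      nlinarith
    have e : f * thetaTerm a b k = (a * b) ^ triangular (k - 1) * (f * a ^ k.toNat) := by
      rw [thetaTerm, show triangular k = triangular (k - 1) + k.toNat by omega]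
      ring
    rw [e, key _ h3]
  · have h3 : d < triangular k := by
      have : (d : ℤ) + 1 < -k := by omega
      zify
      nlinarith
    have e : f * thetaTerm a b k = (a * b) ^ triangular k * (f * b ^ (-k).toNat) := by
      rw [thetaTerm, show triangular (k - 1) = triangular k + (-k).toNat by omega]
      ring
    rw [e, key _ h3]

theorem tendsto_centralGauss {q : ℂ⟦X⟧} (hq : constantCoeff q = 0) (k : ℤ) :
    Tendsto (fun n => centralGauss q n k) atTop (𝓝 (qPoch q q)⁻¹) := by
  have h1 : Tendsto (fun n : ℕ => (n : ℤ) - k) atTop atTop :=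
    tendsto_atTop_add_const_right _ (-k) tendsto_natCast_atTop_atTop
  have h2 : Tendsto (fun n : ℕ => (n : ℤ) + k) atTop atTop :=
    tendsto_atTop_add_const_right _ k tendsto_natCast_atTop_atTop
  have h3 : Tendsto (fun n : ℕ => 2 * n) atTop atTop :=
    tendsto_id.const_mul_atTop' (by norm_num)
  have h := ((hasProd_qPoch q hq).tendsto_prod_nat.comp h3).mul
    (((tendsto_invPochInt hq).comp h1).mul ((tendsto_invPochInt hq).comp h2))
  rw [← mul_assoc, PowerSeries.mul_inv_cancel _ (by simp [constantCoeff_qPoch hq hq]), one_mul] at h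
  exact h

/-- The Jacobi triple product identity, the limit of its finite form as the Gaussian binomials tend
to `1 / (q; q)_∞`. -/
theorem hasSum_thetaTerm {a b : ℂ⟦X⟧} (hq : constantCoeff (a * b) = 0) :
    HasSum (thetaTerm a b)
      (qPoch (-a) (a * b) * qPoch (-b) (a * b) * qPoch (a * b) (a * b)) := by
  have h1 : HasSum (fun k => (qPoch (a * b) (a * b))⁻¹ * thetaTerm a b k)
      (qPoch (-a) (a * b) * qPoch (-b) (a * b)) :=
    hasSum_of_tendsto_of_coeff_eq_zero
      (fun n d k hk => coeff_thetaTerm_mul_eq_zero hq (centralGauss (a * b) n k) hk)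
      (fun k => (tendsto_centralGauss hq k).mul tendsto_const_nhds)
      (hasSum_centralGauss_mul hq)
      ((hasProd_qPoch (-a) hq).mul (hasProd_qPoch (-b) hq)).tendsto_prod_nat
  have h2 := h1.mul_left (qPoch (a * b) (a * b))
  simp_rw [← mul_assoc] at h2
  rw [PowerSeries.mul_inv_cancel _ (by simp [constantCoeff_qPoch hq hq])] at h2
  simp_rw [one_mul] at h2
  rwa [mul_comm _ (qPoch (a * b) (a * b)), ← mul_assoc]

/-! ### Dissection of theta products at fifth roots of unity -/

/-- The Jacobi triple product at `a = c q ^ i`, `b = q ^ j / c`, for a complex number `c`. -/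
theorem hasSum_theta {c : ℂ} (hc : c ≠ 0) {i j : ℕ} (hij : 0 < i + j) :
    HasSum (fun k : ℤ => C (c ^ k) * (X : ℂ⟦X⟧) ^ (i * triangular k + j * triangular (k - 1)))
      (qPoch (-(C c * X ^ i)) (X ^ (i + j)) * qPoch (-(C c⁻¹ * X ^ j)) (X ^ (i + j)) *
        qPoch (X ^ (i + j)) (X ^ (i + j))) := by
  have hab : (C c * X ^ i) * (C c⁻¹ * X ^ j) = (X : ℂ⟦X⟧) ^ (i + j) := by
    have : (C c * C c⁻¹ : ℂ⟦X⟧) = 1 := by rw [← map_mul, mul_inv_cancel₀ hc, map_one]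
    linear_combination X ^ i * X ^ j * this
  have h := hasSum_thetaTerm (a := C c * X ^ i) (b := C c⁻¹ * X ^ j)
    (by rw [hab, map_pow, constantCoeff_X, zero_pow hij.ne'])
  rw [hab] at h
  have e : (fun k : ℤ => C (c ^ k) * (X : ℂ⟦X⟧) ^ (i * triangular k + j * triangular (k - 1))) =
      thetaTerm (C c * X ^ i) (C c⁻¹ * X ^ j) := by
    funext k
    have h1 : c ^ triangular k * c⁻¹ ^ triangular (k - 1) = c ^ k := by
      rw [← zpow_natCast, ← zpow_natCast, inv_zpow', ← zpow_add₀ hc]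
      congr 1
      linarith [triangular_sub_one_add k]
    rw [thetaTerm, ← h1, map_mul, map_pow, map_pow]
    ring
  rwa [e]

theorem qPoch_one {q : ℂ⟦X⟧} (hq : constantCoeff q = 0) : qPoch 1 q = 0 := by
  rw [qPoch_eq_one_sub_mul 1 hq, sub_self, zero_mul]

/-- The subseries over `k ≡ r (mod 5)` of `∑ (-z) ^ k q ^ (k (k - 1) / 2)`. -/
theorem hasSum_theta_residue {z : ℂ} (hz : z ^ 5 = 1) {r : ℤ} {i j e : ℕ} (hij : i + j = 25)
    (hr : (i : ℤ) - j = 5 * (2 * r - 1)) (he : 2 * (e : ℤ) = r * (r - 1)) :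
    HasSum (fun k : ℤ =>
        if k % 5 = r % 5 then C ((-z) ^ k) * (X : ℂ⟦X⟧) ^ triangular (k - 1) else 0)
      (C ((-z) ^ r) * X ^ e * (qPoch (X ^ i) (X ^ 25) * qPoch (X ^ j) (X ^ 25) *
        qPoch (X ^ 25) (X ^ 25))) := by
  have hz0 : -z ≠ 0 := by
    rw [neg_ne_zero]
    rintro rfl
    norm_num at hz
  have h := (hasSum_theta (c := -1) (by norm_num) (i := i) (j := j) (by omega)).mul_left
    (C ((-z) ^ r) * X ^ e)
  have e1 : ((-1 : ℂ))⁻¹ = -1 := by norm_num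
  rw [hij, e1] at h
  simp only [map_neg, map_one, neg_mul, one_mul, neg_neg] at h
  have hinj : Function.Injective fun m : ℤ => 5 * m + r := fun m n hmn => by
    simp only at hmn
    omega
  refine (hinj.hasSum_iff fun k hk => if_neg fun h5 => hk ⟨(k - r) / 5, ?_⟩).mp ?_
  · simp only
    omega
  · refine (congrArg (fun F => HasSum F _) (funext fun m => ?_)).mpr h
    rw [Function.comp_apply, if_pos (by omega)]
    have h1 : (-z) ^ (5 * m + r) = (-1) ^ m * (-z) ^ r := by
      rw [zpow_add₀ hz0, zpow_mul]
      congr 2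
      have : (-z) ^ (5 : ℤ) = (-z) ^ 5 := by norm_cast
      rw [this, neg_pow, hz]
      norm_num
    have h2 : triangular (5 * m + r - 1) = e + (i * triangular m + j * triangular (m - 1)) := by
      have t1 := two_mul_triangular (5 * m + r - 1)
      have t2 := two_mul_triangular m
      have t3 := two_mul_triangular (m - 1)
      have hi : (i : ℤ) = 10 + 5 * r := by omega
      have hj : (j : ℤ) = 15 - 5 * r := by omega
      zify
      rw [hi, hj]
      refine mul_left_cancel₀ (two_ne_zero (α := ℤ)) ?_
      linear_combination t1 - he - (10 + 5 * r) * t2 - (15 - 5 * r) * t3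
    rw [h1, h2, map_mul, pow_add]
    ring

/-- The 5-dissection of `(q, z q, q / z; q)_∞` at a primitive fifth root of unity `z`: in the theta
series of `(z, q / z, q; q)_∞ = (1 - z) (z q, q / z, q; q)_∞` the terms `k ≡ 0, 1` and the terms
`k ≡ 2, 4 (mod 5)` give the same two theta products, and those with `k ≡ 3` cancel. -/
theorem theta_dissection {z : ℂ} (hz : z ^ 5 = 1) (hz1 : z ≠ 1) :
    qPoch X X * (qPoch (C z * X) X * qPoch (C z⁻¹ * X) X) =
      qPoch (X ^ 10) (X ^ 25) * qPoch (X ^ 15) (X ^ 25) * qPoch (X ^ 25) (X ^ 25) -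
      (1 + C z + C z⁻¹) * X *
        (qPoch (X ^ 5) (X ^ 25) * qPoch (X ^ 20) (X ^ 25) * qPoch (X ^ 25) (X ^ 25)) := by
  have hz0 : z ≠ 0 := by
    rintro rfl
    norm_num at hz
  have h0 := hasSum_theta_residue hz (r := 0) (i := 10) (j := 15) (e := 0) (by norm_num)
    (by norm_num) (by norm_num)
  have h1 := hasSum_theta_residue hz (r := 1) (i := 15) (j := 10) (e := 0) (by norm_num)
    (by norm_num) (by norm_num)
  have h2 := hasSum_theta_residue hz (r := 2) (i := 20) (j := 5) (e := 1) (by norm_num)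
    (by norm_num) (by norm_num)
  have h3 := hasSum_theta_residue hz (r := 3) (i := 25) (j := 0) (e := 3) (by norm_num)
    (by norm_num) (by norm_num)
  have h4 := hasSum_theta_residue hz (r := -1) (i := 5) (j := 20) (e := 1) (by norm_num)
    (by norm_num) (by norm_num)
  have h := hasSum_theta (c := -z) (neg_ne_zero.mpr hz0) (i := 0) (j := 1) (by norm_num)
  have hsum := (((h0.add h1).add h2).add h3).add h4
  have hf : (fun k : ℤ => C ((-z) ^ k) * (X : ℂ⟦X⟧) ^ (0 * triangular k + 1 * triangular (k - 1))) =
      fun k : ℤ =>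
      (((((if k % 5 = 0 % 5 then C ((-z) ^ k) * (X : ℂ⟦X⟧) ^ triangular (k - 1) else 0) +
      if k % 5 = 1 % 5 then C ((-z) ^ k) * (X : ℂ⟦X⟧) ^ triangular (k - 1) else 0) +
      if k % 5 = 2 % 5 then C ((-z) ^ k) * (X : ℂ⟦X⟧) ^ triangular (k - 1) else 0) +
      if k % 5 = 3 % 5 then C ((-z) ^ k) * (X : ℂ⟦X⟧) ^ triangular (k - 1) else 0) +
      if k % 5 = -1 % 5 then C ((-z) ^ k) * (X : ℂ⟦X⟧) ^ triangular (k - 1) else 0) := by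
    funext k
    have hk : k % 5 = 0 ∨ k % 5 = 1 ∨ k % 5 = 2 ∨ k % 5 = 3 ∨ k % 5 = 4 := by omega
    rcases hk with hk | hk | hk | hk | hk <;> simp [hk]
  rw [hf] at h
  -- the residue `3` gives a product with the vanishing factor `1 - q ^ 0`
  have key := h.unique hsum
  have hX : constantCoeff (X : ℂ⟦X⟧) = 0 := constantCoeff_X
  have hX25 : constantCoeff ((X : ℂ⟦X⟧) ^ 25) = 0 := by simp
  have hinv : (C (-z)⁻¹ : ℂ⟦X⟧) = -C z⁻¹ := by rw [inv_neg, map_neg]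
  have hZ : (C z * C z⁻¹ : ℂ⟦X⟧) = 1 := by rw [← map_mul, mul_inv_cancel₀ hz0, map_one]
  simp only [zero_add, pow_zero, pow_one, mul_one, qPoch_one hX25, zpow_zero, zpow_one,
    zpow_neg_one, hinv, map_neg, map_one, neg_neg, neg_mul,
    qPoch_eq_one_sub_mul (C z) hX] at key
  rw [show (-z) ^ (2 : ℤ) = z ^ 2 by rw [← neg_sq z]; norm_cast, map_pow] at key
  have hne : (1 - C z : ℂ⟦X⟧) ≠ 0 := by
    rw [sub_ne_zero, ← map_one (C (R := ℂ))]
    exact fun h => hz1 (C_injective h).symm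
  refine mul_left_cancel₀ hne ?_
  linear_combination key - (qPoch (X ^ 5) (X ^ 25) * qPoch (X ^ 20) (X ^ 25) *
    qPoch (X ^ 25) (X ^ 25)) * X * hZ

theorem one_add_root_sum {z : ℂ} (hz : z ^ 5 = 1) (hz1 : z ≠ 1) :
    1 + z + z⁻¹ + (z ^ 2 + (z ^ 2)⁻¹) = 0 := by
  have hz0 : z ≠ 0 := by
    rintro rfl
    norm_num at hz
  have h1 : 1 + z + z ^ 2 + z ^ 3 + z ^ 4 = 0 :=
    mul_left_cancel₀ (sub_ne_zero.mpr hz1) (by linear_combination hz)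
  have h2 : z⁻¹ = z ^ 4 := inv_eq_of_mul_eq_one_right (by linear_combination hz)
  have h3 : (z ^ 2)⁻¹ = z ^ 3 := inv_eq_of_mul_eq_one_right (by linear_combination hz)
  rw [h2, h3]
  linear_combination h1

/-- `(q; q)_∞ (z q, q / z; q)_∞ (z² q, q / z²; q)_∞ = (q⁵; q⁵)_∞`. -/
theorem prod_qPoch_roots {z : ℂ} (hz : z ^ 5 = 1) (hz1 : z ≠ 1) :
    qPoch X X * (qPoch (C z * X) X * qPoch (C z⁻¹ * X) X) *
      (qPoch (C (z ^ 2) * X) X * qPoch (C (z ^ 2)⁻¹ * X) X) = qPoch (X ^ 5) (X ^ 5) := by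
  have hz0 : z ≠ 0 := by
    rintro rfl
    norm_num at hz
  have hX : constantCoeff (X : ℂ⟦X⟧) = 0 := constantCoeff_X
  have h := ((hasProd_qPoch X hX).mul ((hasProd_qPoch (C z * X) hX).mul
    (hasProd_qPoch (C z⁻¹ * X) hX))).mul ((hasProd_qPoch (C (z ^ 2) * X) hX).mul
    (hasProd_qPoch (C (z ^ 2)⁻¹ * X) hX))
  have e : (fun n : ℕ => (1 - (X : ℂ⟦X⟧) * X ^ n) *
      ((1 - C z * X * X ^ n) * (1 - C z⁻¹ * X * X ^ n)) *
      ((1 - C (z ^ 2) * X * X ^ n) * (1 - C (z ^ 2)⁻¹ * X * X ^ n))) =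
      fun n => 1 - X ^ 5 * (X ^ 5) ^ n := by
    funext n
    have hZ : (C z * C z⁻¹ : ℂ⟦X⟧) = 1 := by rw [← map_mul, mul_inv_cancel₀ hz0, map_one]
    have hs : (1 + C z + C z⁻¹ + (C z ^ 2 + C z⁻¹ ^ 2) : ℂ⟦X⟧) = 0 := by
      rw [← map_pow, ← map_pow, inv_pow, ← map_one (C (R := ℂ)), ← map_add, ← map_add, ← map_add,
        ← map_add, one_add_root_sum hz hz1, map_zero]
    rw [← inv_pow, map_pow, map_pow]
    generalize (C z : ℂ⟦X⟧) = a at *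
    generalize (C z⁻¹ : ℂ⟦X⟧) = b at *
    have hx : (X : ℂ⟦X⟧) ^ 5 * (X ^ 5) ^ n = (X * X ^ n) ^ 5 := by ring
    rw [hx]
    simp only [mul_assoc _ (X : ℂ⟦X⟧)]
    generalize (X : ℂ⟦X⟧) * X ^ n = x
    have h1 : (1 - a * x) * (1 - b * x) = 1 - (a + b) * x + x ^ 2 := by
      linear_combination x ^ 2 * hZ
    have h2 : (1 - a ^ 2 * x) * (1 - b ^ 2 * x) = 1 + (1 + a + b) * x + x ^ 2 := by
      linear_combination x ^ 2 * (a * b + 1) * hZ - x * hs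
    have h3 : (a + b) ^ 2 = 1 - (a + b) := by
      linear_combination hs + 2 * hZ
    rw [h1, h2]
    linear_combination (-(x ^ 2) + x ^ 3) * h3
  rw [e] at h
  exact h.unique (hasProd_qPoch _ (by simp))

/-! ### Dissection of the crank product -/

/-- The factors of `(q; q)_∞` sorted by the residue of the exponent modulo `5`. -/
theorem qPoch_self_eq_prod {q : ℂ⟦X⟧} (hq : constantCoeff q = 0) :
    qPoch q q = qPoch q (q ^ 5) * qPoch (q ^ 4) (q ^ 5) *
      (qPoch (q ^ 2) (q ^ 5) * qPoch (q ^ 3) (q ^ 5)) * qPoch (q ^ 5) (q ^ 5) := by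
  have hq5 : constantCoeff (q ^ 5) = 0 := by simp [hq]
  have h := ((((hasProd_qPoch q hq5).mul (hasProd_qPoch (q ^ 4) hq5)).mul
    ((hasProd_qPoch (q ^ 2) hq5).mul (hasProd_qPoch (q ^ 3) hq5))).mul
    (hasProd_qPoch (q ^ 5) hq5)).tendsto_prod_nat
  have h5 : Tendsto (fun n : ℕ => 5 * n) atTop atTop := tendsto_id.const_mul_atTop' (by norm_num)
  refine tendsto_nhds_unique ((hasProd_qPoch q hq).tendsto_prod_nat.comp h5) (h.congr fun n => ?_)
  induction n with
  | zero => simp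
  | succ n ih =>
    rw [Function.comp_apply] at ih ⊢
    rw [Finset.prod_range_succ, ih, mul_add_one]
    simp only [Finset.prod_range_succ]
    ring

/-- The crank generating function `(q; q)_∞ / (z q, q / z; q)_∞`. -/
noncomputable def crankProduct (z : ℂ) : ℂ⟦X⟧ :=
  qPoch X X * (qPoch (C z * X) X * qPoch (C z⁻¹ * X) X)⁻¹

/-- Let `P_z = (q, z q, q / z; q)_∞`. As `P_z P_{z²} = (q; q)_∞ (q⁵; q⁵)_∞`, the crank product
`(q; q)_∞² / P_z` equals `P_z P_{z²}² / (q⁵; q⁵)_∞²`, where each factor of the numerator has the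
two-term dissection `theta_dissection`; the four terms of the product are those below. -/
theorem crankProduct_dissection {z : ℂ} (hz : z ^ 5 = 1) (hz1 : z ≠ 1) :
    crankProduct z = serA (X ^ 5) - X * (2 + C z ^ 2 + C z⁻¹ ^ 2) * serB (X ^ 5) +
      X ^ 2 * (C z ^ 2 + C z⁻¹ ^ 2) * serC (X ^ 5) - X ^ 3 * (C z + C z⁻¹) * serD (X ^ 5) := by
  have hz0 : z ≠ 0 := by
    rintro rfl
    norm_num at hz
  have hX : constantCoeff (X : ℂ⟦X⟧) = 0 := constantCoeff_X
  have hZ : (C z * C z⁻¹ : ℂ⟦X⟧) = 1 := by rw [← map_mul, mul_inv_cancel₀ hz0, map_one]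
  have hs : (1 + C z + C z⁻¹ + (C z ^ 2 + C z⁻¹ ^ 2) : ℂ⟦X⟧) = 0 := by
    rw [← map_pow, ← map_pow, inv_pow, ← map_one (C (R := ℂ)), ← map_add, ← map_add, ← map_add,
      ← map_add, one_add_root_sum hz hz1, map_zero]
  have hz2 : z ^ 2 ≠ 1 := fun h => hz1 (by linear_combination hz - (z ^ 3 + z) * h)
  have t1 := theta_dissection hz hz1
  have t2 := theta_dissection (z := z ^ 2) (by rw [← pow_mul, pow_mul', hz, one_pow]) hz2
  have t3 := prod_qPoch_roots hz hz1
  have t4 := qPoch_self_eq_prod (q := (X : ℂ⟦X⟧) ^ 5) (by simp)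
  have hp1 : ∀ w : ℂ, constantCoeff (qPoch (C w * X) X) = 1 := fun w =>
    constantCoeff_qPoch (by simp) hX
  have hp2 : ∀ i j : ℕ, 0 < i → 0 < j → constantCoeff (qPoch ((X : ℂ⟦X⟧) ^ i) (X ^ j)) = 1 :=
    fun i j hi hj => constantCoeff_qPoch (by simp [hi.ne']) (by simp [hj.ne'])
  rw [crankProduct, serA, serB, serC, serD]
  simp only [← pow_mul, Nat.reduceMul] at t4 ⊢
  have ha : constantCoeff (qPoch ((X : ℂ⟦X⟧) ^ 5) (X ^ 25) * qPoch (X ^ 20) (X ^ 25)) ≠ 0 := by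
    simp [hp2]
  have hb : constantCoeff (qPoch ((X : ℂ⟦X⟧) ^ 10) (X ^ 25) * qPoch (X ^ 15) (X ^ 25)) ≠ 0 := by
    simp [hp2]
  have hc : constantCoeff (qPoch ((X : ℂ⟦X⟧) ^ 25) (X ^ 25)) ≠ 0 := by
    simp [hp2]
  have hp : constantCoeff (qPoch (C z * X) X * qPoch (C z⁻¹ * X) X) ≠ 0 := by
    simp [hp1]
  rw [← inv_pow, map_pow, map_pow] at t2
  rw [← inv_pow, map_pow, map_pow] at t3
  generalize qPoch (X : ℂ⟦X⟧) X = e at *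
  generalize qPoch (C z * X) X * qPoch (C z⁻¹ * X) X = p at *
  generalize qPoch (C z ^ 2 * X) X * qPoch (C z⁻¹ ^ 2 * X) X = p₂ at *
  generalize qPoch ((X : ℂ⟦X⟧) ^ 5) (X ^ 25) * qPoch (X ^ 20) (X ^ 25) = a at *
  generalize qPoch ((X : ℂ⟦X⟧) ^ 10) (X ^ 25) * qPoch (X ^ 15) (X ^ 25) = b at *
  generalize qPoch ((X : ℂ⟦X⟧) ^ 25) (X ^ 25) = c at *
  rw [t4] at t3
  have ip := PowerSeries.mul_inv_cancel p hp
  have ia := PowerSeries.mul_inv_cancel a ha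
  have ib := PowerSeries.mul_inv_cancel b hb
  have ia2 := PowerSeries.mul_inv_cancel (a ^ 2) (by simpa using ha)
  have ib2 := PowerSeries.mul_inv_cancel (b ^ 2) (by simpa using hb)
  have hN : (a * b * c) ^ 2 ≠ 0 := by
    intro h
    have := congrArg (constantCoeff (R := ℂ)) h
    simp only [map_pow, map_mul, map_zero] at this
    exact pow_ne_zero 2 (mul_ne_zero (mul_ne_zero ha hb) hc) this
  refine mul_right_cancel₀ hN ?_
  have l1 : e * p⁻¹ * (a * b * c) ^ 2 = (e * p) * (e * p₂) ^ 2 := by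
    rw [← t3]
    linear_combination e ^ 3 * p * p₂ ^ 2 * ip
  have r1 : b * c * (a ^ 2)⁻¹ * (a * b * c) ^ 2 = (b * c) ^ 3 := by
    linear_combination (b * c) ^ 3 * ia2
  have r2 : c * a⁻¹ * (a * b * c) ^ 2 = (b * c) ^ 2 * (a * c) := by
    linear_combination a * b ^ 2 * c ^ 3 * ia
  have r3 : c * b⁻¹ * (a * b * c) ^ 2 = (b * c) * (a * c) ^ 2 := by
    linear_combination b * a ^ 2 * c ^ 3 * ib
  have r4 : a * c * (b ^ 2)⁻¹ * (a * b * c) ^ 2 = (a * c) ^ 3 := by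
    linear_combination (a * c) ^ 3 * ib2
  -- everything is a polynomial in `U = z + 1 / z`, and `U ^ 2 + U = 1`
  obtain ⟨U, hU⟩ : ∃ U : ℂ⟦X⟧, U = C z + C z⁻¹ := ⟨_, rfl⟩
  have hV : (C z ^ 2 + C z⁻¹ ^ 2 : ℂ⟦X⟧) = -1 - U := by linear_combination hs + hU
  have hUU : U ^ 2 + U - 1 = 0 := by
    rw [hU]
    linear_combination hs + 2 * hZ
  have t1' : e * p = b * c - (1 + U) * X * (a * c) := by rw [t1, hU]; ring
  have t2' : e * p₂ = b * c + U * X * (a * c) := by linear_combination t2 - X * (a * c) * hV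
  have h2V : (2 + C z ^ 2 + C z⁻¹ ^ 2 : ℂ⟦X⟧) = 1 - U := by linear_combination hV
  rw [l1, t1', t2', h2V, hV, ← hU]
  linear_combination -r1 + X * (1 - U) * r2 - X ^ 2 * (-1 - U) * r3 + X ^ 3 * U * r4 -
    (X ^ 2 * (b * c) * (a * c) ^ 2 + X ^ 3 * U * (a * c) ^ 3) * hUU

/-! ### Partitions sorted by their number of ones -/

/-- The weight of a part `i` of multiplicity `j`: the partitions with exactly `w` ones are weighted
by `t * z ^ (number of parts larger than w)`. `Nat.Partition.genFun` gives multiplicity `0` the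
weight `1`, so the partitions without ones are counted too, independently of `t`; the difference of
the values at `t = 1` and `t = 0` removes them. -/
noncomputable def crankWeight (z t : ℂ) (w i j : ℕ) : ℂ :=
  (if i = 1 then if j = w then t else 0 else 1) * (if w < i then z else 1) ^ j

theorem prod_map_ite_lt (z : ℂ) (w : ℕ) (s : Multiset ℕ) :
    (s.map fun i => if w < i then z else 1).prod = z ^ (s.filter (fun i => w < i)).card := by
  induction s using Multiset.induction with
  | empty => simp
  | cons a s ih =>
    rw [Multiset.map_cons, Multiset.prod_cons, ih]
    by_cases h : w < a
    · rw [if_pos h, Multiset.filter_cons_of_pos _ h, Multiset.card_cons, pow_succ']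
    · rw [if_neg h, Multiset.filter_cons_of_neg _ h, one_mul]

theorem prod_crankWeight (z t : ℂ) (w : ℕ) {n : ℕ} (π : n.Partition) :
    π.parts.toFinsupp.prod (crankWeight z t w) =
      (if omega π = 0 then 1 else if omega π = w then t else 0) *
        z ^ (π.parts.filter (fun i => w < i)).card := by
  rw [← prod_map_ite_lt, Finset.prod_multiset_map_count, Finsupp.prod, Multiset.toFinsupp_support]
  simp only [Multiset.toFinsupp_apply, crankWeight]
  rw [Finset.prod_mul_distrib, Finset.prod_ite_eq']
  congr 1
  simp only [omega, Multiset.mem_toFinset, Multiset.count_eq_zero]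
  by_cases h : 1 ∈ π.parts
  · simp only [h, if_true, not_true, if_false]
    congr
  · simp [h]

/-- The generating function of the number of ones, refined by `z ^ crank`. -/
noncomputable def onesCrankSeries (z : ℂ) : ℂ⟦X⟧ :=
  PowerSeries.mk fun n => ∑ π : n.Partition, (omega π : ℂ) * z ^ crank π

/-- Sorting the partitions by their number `w` of ones. -/
theorem hasSum_genFun_crankWeight {z : ℂ} (hz : z ≠ 0) :
    HasSum (fun w : ℕ => C (w * z⁻¹ ^ w) * (Nat.Partition.genFun (crankWeight z 1 w) -
      Nat.Partition.genFun (crankWeight z 0 w))) (onesCrankSeries z) := by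
  rw [PowerSeries.WithPiTopology.hasSum_iff_hasSum_coeff]
  intro n
  rw [onesCrankSeries, coeff_mk]
  simp only [coeff_C_mul, map_sub, Nat.Partition.coeff_genFun, ← Finset.sum_sub_distrib,
    Finset.mul_sum, prod_crankWeight]
  refine hasSum_sum fun π _ => ?_
  have e : (omega π : ℂ) * z ^ crank π = omega π * z⁻¹ ^ omega π *
      ((if omega π = 0 then 1 else if omega π = omega π then 1 else 0) *
        z ^ (π.parts.filter (fun i => omega π < i)).card -
        (if omega π = 0 then 1 else if omega π = omega π then 0 else 0) *
        z ^ (π.parts.filter (fun i => omega π < i)).card) := by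
    by_cases h : omega π = 0
    · simp [h]
    · simp only [h, if_false, if_true, crank, mu]
      rw [zpow_sub₀ hz, zpow_natCast, zpow_natCast, inv_pow]
      ring
  rw [e]
  refine hasSum_single (omega π) fun w hw => ?_
  by_cases h : omega π = 0
  · simp [h]
  · simp [h, hw.symm]

theorem one_add_tsum_pow_succ {x : ℂ⟦X⟧} (hx : constantCoeff x = 0) :
    1 + ∑' j : ℕ, x ^ (j + 1) = (1 - x)⁻¹ := by
  have h := PowerSeries.WithPiTopology.tsum_pow_mul_one_sub_of_constantCoeff_eq_zero hx
  have h1 := (PowerSeries.WithPiTopology.summable_pow_of_constantCoeff_eq_zero hx).tsum_eq_zero_add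
  rw [pow_zero] at h1
  rw [← h1]
  exact (inv_eq_of_mul_eq_one (by rw [mul_comm]; exact h)).symm

/-- `(z q; q)_w / (q; q)_w`. -/
noncomputable def qPochRatio (z : ℂ) (w : ℕ) : ℂ⟦X⟧ :=
  ∏ i ∈ Finset.range w, (1 - C z * X * X ^ i) * (1 - X * X ^ i)⁻¹

/-- The product `∏ 1 / (1 - q ^ i) (2 ≤ i ≤ w) ∏ 1 / (1 - z q ^ i) (i > w)`, with the factor
`1 + t q ^ w` for the ones. -/
theorem genFun_crankWeight (z t : ℂ) {w : ℕ} (hw : w ≠ 0) :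
    Nat.Partition.genFun (crankWeight z t w) =
      (qPoch (C z * X) X)⁻¹ * ((1 + C t * X ^ w) * (1 - X) * qPochRatio z w) := by
  have hX : constantCoeff (X : ℂ⟦X⟧) = 0 := constantCoeff_X
  have hg := Nat.Partition.hasProd_genFun (crankWeight z t w)
  -- the finitely many factors in which the product differs from `1 / (z q; q)_∞`
  let c : ℕ → ℂ⟦X⟧ := fun i => if i = 0 then (1 + C t * X ^ w) * (1 - C z * X * X ^ i) else
    if i < w then (1 - C z * X * X ^ i) * (1 - X * X ^ i)⁻¹ else 1
  have hc : HasProd c (∏ i ∈ Finset.range w, c i) := by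
    refine hasProd_prod_of_ne_finset_one fun i hi => ?_
    rw [Finset.mem_range] at hi
    simp only [c]
    rw [if_neg (by omega), if_neg hi]
  have h := (hasProd_inv_qPoch (a := C z * X) (q := X) (by simp) hX).mul hc
  have e : (fun i : ℕ => (1 - C z * X * X ^ i)⁻¹ * c i) = fun i : ℕ => 1 + ∑' j : ℕ,
      crankWeight z t w (i + 1) (j + 1) • (X : ℂ⟦X⟧) ^ ((i + 1) * (j + 1)) := by
    funext i
    have hi := one_sub_mul_inv_cancel (f := C z * X * X ^ i) (by simp)
    by_cases h0 : i = 0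
    · subst h0
      obtain ⟨v, rfl⟩ : ∃ v, w = v + 1 := ⟨w - 1, by omega⟩
      rw [tsum_eq_single v fun j hj => by simp [crankWeight, hj]]
      simp only [c, crankWeight, if_true, zero_add, one_mul, if_neg (by omega : ¬ v + 1 < 1),
        one_pow, mul_one, smul_eq_C_mul]
      linear_combination (1 + C t * X ^ (v + 1)) * hi
    · have hgeom : ∀ b : ℂ, 1 + ∑' j : ℕ, (b ^ (j + 1)) • (X : ℂ⟦X⟧) ^ ((i + 1) * (j + 1)) =
          (1 - C b * X * X ^ i)⁻¹ := fun b => by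
        rw [← one_add_tsum_pow_succ (by simp)]
        congr 2
        funext j
        rw [smul_eq_C_mul, map_pow, pow_mul]
        ring
      simp only [c, crankWeight, if_neg h0, if_neg (by omega : ¬ i + 1 = 1), one_mul]
      by_cases hiw : i < w
      · simp only [if_pos hiw, if_neg (by omega : ¬ w < i + 1)]
        rw [hgeom 1, map_one, one_mul]
        linear_combination (1 - X * X ^ i)⁻¹ * hi
      · simp only [if_neg hiw, if_pos (by omega : w < i + 1)]
        rw [hgeom z, mul_one]
  rw [e] at h
  rw [hg.unique h]
  congr 1
  obtain ⟨v, rfl⟩ : ∃ v, w = v + 1 := ⟨w - 1, by omega⟩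
  have e2 : ∏ i ∈ Finset.range v, c (i + 1) =
      ∏ i ∈ Finset.range v, (1 - C z * X * X ^ (i + 1)) * (1 - (X : ℂ⟦X⟧) * X ^ (i + 1))⁻¹ := by
    refine Finset.prod_congr rfl fun i hi => ?_
    rw [Finset.mem_range] at hi
    simp only [c]
    rw [if_neg (by omega), if_pos (by omega)]
  rw [qPochRatio, Finset.prod_range_succ', Finset.prod_range_succ', e2]
  simp only [c, if_true, pow_zero, mul_one]
  linear_combination -(∏ i ∈ Finset.range v,
    (1 - C z * X * X ^ (i + 1)) * (1 - (X : ℂ⟦X⟧) * X ^ (i + 1))⁻¹) * (1 + C t * X ^ (v + 1)) *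
    (1 - C z * X) * one_sub_mul_inv_cancel hX

/-! ### The `q`-binomial series and its logarithmic derivative -/

/-- The summand `(z q; q)_w / (q; q)_w (q / z) ^ w` of the `q`-binomial series. -/
noncomputable def binomTerm (z : ℂ) (w : ℕ) : ℂ⟦X⟧ := X ^ w * (C (z⁻¹ ^ w) * qPochRatio z w)

/-- The `q`-binomial series `∑ φ(w) (z q; q)_w / (q; q)_w (q ^ (n + 1) / z) ^ w`, with weights
`φ(w)`. -/
noncomputable def binomSeries (z : ℂ) (φ : ℕ → ℕ) (n : ℕ) : ℂ⟦X⟧ :=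
  ∑' w : ℕ, (φ w : ℂ⟦X⟧) * binomTerm z w * X ^ (n * w)

theorem hasSum_binomSeries (z : ℂ) (φ : ℕ → ℕ) (n : ℕ) :
    HasSum (fun w : ℕ => (φ w : ℂ⟦X⟧) * binomTerm z w * X ^ (n * w)) (binomSeries z φ n) := by
  refine (PowerSeries.WithPiTopology.summable_of_tendsto_order_atTop_nhds_top _
    (tendsto_order fun w => ?_)).hasSum
  rw [binomTerm, mul_left_comm, mul_assoc]
  exact le_order_pow_mul constantCoeff_X w _

theorem onesCrankSeries_eq_mul_binomSeries {z : ℂ} (hz : z ≠ 0) :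
    onesCrankSeries z = (qPoch (C z * X) X)⁻¹ * (1 - X) * binomSeries z id 0 := by
  refine (hasSum_genFun_crankWeight hz).unique ?_
  refine (congrArg (fun F => HasSum F _) (funext fun w => ?_)).mpr
    ((hasSum_binomSeries z id 0).mul_left ((qPoch (C z * X) X)⁻¹ * (1 - X)))
  -- `genFun_crankWeight` fails for `w = 0`, but there the coefficient `w` vanishes
  rcases Nat.eq_zero_or_pos w with rfl | hw
  · simp
  · rw [genFun_crankWeight z 1 hw.ne', genFun_crankWeight z 0 hw.ne', binomTerm, map_mul,
      map_zero, map_one, map_natCast, id]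
    ring

theorem binomTerm_succ {z : ℂ} (hz : z ≠ 0) (w : ℕ) :
    binomTerm z (w + 1) * (1 - X ^ (w + 1)) = (C z⁻¹ - X ^ (w + 1)) * X * binomTerm z w := by
  have h1 := one_sub_mul_inv_cancel (f := (X : ℂ⟦X⟧) * X ^ w) (by simp)
  have hZ : (C z * C z⁻¹ : ℂ⟦X⟧) = 1 := by rw [← map_mul, mul_inv_cancel₀ hz, map_one]
  rw [binomTerm, binomTerm, qPochRatio, Finset.prod_range_succ, ← qPochRatio, map_pow, map_pow]
  linear_combination X ^ (w + 1) * C z⁻¹ ^ (w + 1) * qPochRatio z w * (1 - C z * X * X ^ w) * h1 -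
    X ^ w * C z⁻¹ ^ w * qPochRatio z w * X * X ^ (w + 1) * hZ

/-- The `q`-difference equation of the `q`-binomial series. The weights `φ = id` stand for
`x d/dx`, with `x` the variable of the series, so that no derivative is needed. -/
theorem binomSeries_sub {z : ℂ} (hz : z ≠ 0) (φ : ℕ → ℕ) (n : ℕ) :
    binomSeries z φ n - binomSeries z φ (n + 1) =
      C z⁻¹ * X ^ (n + 1) * binomSeries z (fun w => φ (w + 1)) n -
        X ^ (n + 2) * binomSeries z (fun w => φ (w + 1)) (n + 1) := by
  have h1 := (hasSum_nat_add_iff' 1).mpr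
    ((hasSum_binomSeries z φ n).sub (hasSum_binomSeries z φ (n + 1)))
  have h2 := ((hasSum_binomSeries z (fun w => φ (w + 1)) n).mul_left (C z⁻¹ * X ^ (n + 1))).sub
    ((hasSum_binomSeries z (fun w => φ (w + 1)) (n + 1)).mul_left (X ^ (n + 2)))
  rw [Finset.sum_range_one, mul_zero, mul_zero, sub_self, sub_zero] at h1
  refine h1.unique ((congrArg (fun F => HasSum F _) (funext fun w => ?_)).mpr h2)
  linear_combination (φ (w + 1) : ℂ⟦X⟧) * X ^ (n * (w + 1)) * binomTerm_succ hz w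

theorem X_pow_dvd_of_hasSum {ι : Type*} {f : ι → ℂ⟦X⟧} {a : ℂ⟦X⟧} {m : ℕ} (h : HasSum f a)
    (hf : ∀ i, X ^ m ∣ f i) : X ^ m ∣ a := by
  rw [PowerSeries.X_pow_dvd_iff]
  intro d hd
  refine ((PowerSeries.WithPiTopology.hasSum_iff_hasSum_coeff _).mp h d).unique ?_
  simp_rw [PowerSeries.X_pow_dvd_iff.mp (hf _) d hd]
  exact hasSum_zero

theorem X_pow_dvd_binomSeries_sub (z : ℂ) (φ : ℕ → ℕ) (n : ℕ) :
    X ^ (n + 1) ∣ binomSeries z φ n - (φ 0 : ℂ⟦X⟧) := by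
  have h1 := (hasSum_nat_add_iff' 1).mpr (hasSum_binomSeries z φ n)
  have e : binomTerm z 0 = 1 := by simp [binomTerm, qPochRatio]
  rw [Finset.sum_range_one, mul_zero, pow_zero, mul_one, e, mul_one] at h1
  refine X_pow_dvd_of_hasSum h1 fun w => ?_
  refine ⟨(φ (w + 1) : ℂ⟦X⟧) * X ^ w * (C (z⁻¹ ^ (w + 1)) * qPochRatio z (w + 1)) * X ^ (n * w), ?_⟩
  rw [binomTerm]
  ring

theorem constantCoeff_binomSeries_one (z : ℂ) (n : ℕ) :
    constantCoeff (binomSeries z (fun _ => 1) n) = 1 := by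
  have h := X_dvd_iff.mp ((dvd_pow_self X n.succ_ne_zero).trans
    (X_pow_dvd_binomSeries_sub z (fun _ => 1) n))
  rw [map_sub, Nat.cast_one, map_one, sub_eq_zero] at h
  exact h

theorem binomSeries_one_succ {z : ℂ} (hz : z ≠ 0) (n : ℕ) :
    binomSeries z (fun _ => 1) n * (1 - C z⁻¹ * X * X ^ n) =
      (1 - X * X * X ^ n) * binomSeries z (fun _ => 1) (n + 1) := by
  linear_combination binomSeries_sub hz (fun _ => 1) n

theorem binomSeries_id_succ {z : ℂ} (hz : z ≠ 0) (n : ℕ) :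
    binomSeries z id n * (1 - C z⁻¹ * X * X ^ n) -
        C z⁻¹ * X * X ^ n * binomSeries z (fun _ => 1) n =
      (1 - X * X * X ^ n) * binomSeries z id (n + 1) -
        X * X * X ^ n * binomSeries z (fun _ => 1) (n + 1) := by
  have h : ∀ m, binomSeries z (fun w => id (w + 1)) m =
      binomSeries z id m + binomSeries z (fun _ => 1) m := fun m => by
    refine (hasSum_binomSeries z _ m).unique ((congrArg (fun F => HasSum F _)
      (funext fun w => ?_)).mpr ((hasSum_binomSeries z id m).add (hasSum_binomSeries z _ m)))
    simp only [id]
    push_cast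
    ring
  have h1 := binomSeries_sub hz id n
  rw [h, h] at h1
  linear_combination h1

/-- The `q`-binomial theorem, for the series at hand. -/
theorem binomSeries_one_zero_mul {z : ℂ} (hz : z ≠ 0) :
    binomSeries z (fun _ => 1) 0 * qPoch (C z⁻¹ * X) X = qPoch (X * X) X := by
  have hX : constantCoeff (X : ℂ⟦X⟧) = 0 := constantCoeff_X
  have h : ∀ n : ℕ, binomSeries z (fun _ => 1) 0 *
      ∏ j ∈ Finset.range n, (1 - C z⁻¹ * X * X ^ j) =
      (∏ j ∈ Finset.range n, (1 - X * X * X ^ j)) * binomSeries z (fun _ => 1) n := by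
    intro n
    induction n with
    | zero => simp
    | succ n ih =>
      rw [Finset.prod_range_succ, Finset.prod_range_succ, ← mul_assoc, ih]
      linear_combination (∏ j ∈ Finset.range n, (1 - X * X * X ^ j)) * binomSeries_one_succ hz n
  have hlim : Tendsto (fun n => binomSeries z (fun _ => 1) n) atTop (𝓝 1) := by
    have := (tendsto_zero_of_X_pow_dvd fun n => (pow_dvd_pow X n.le_succ).trans
      (X_pow_dvd_binomSeries_sub z (fun _ => 1) n)).add_const 1
    simpa using this
  have h1 := (hasProd_qPoch (C z⁻¹ * X) hX).tendsto_prod_nat.const_mul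
    (binomSeries z (fun _ => 1) 0)
  have h2 := (hasProd_qPoch (X * X) hX).tendsto_prod_nat.mul hlim
  rw [mul_one] at h2
  exact tendsto_nhds_unique h1 (h2.congr fun n => (h n).symm)

/-- The Lambert series `∑ y q ^ n / (1 - y q ^ n)` over `n ≥ 1`. -/
noncomputable def lambert (y : ℂ) : ℂ⟦X⟧ :=
  ∑' n : ℕ, C y * X * X ^ n * (1 - C y * X * X ^ n)⁻¹

theorem hasSum_lambert (y : ℂ) :
    HasSum (fun n : ℕ => C y * X * X ^ n * (1 - C y * X * X ^ n)⁻¹) (lambert y) := by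
  refine (PowerSeries.WithPiTopology.summable_of_tendsto_order_atTop_nhds_top _
    (tendsto_order fun n => ?_)).hasSum
  rw [mul_comm _ (X ^ n), mul_assoc]
  exact le_order_pow_mul constantCoeff_X n _

/-- Logarithmic differentiation of the `q`-binomial theorem: the quotients of the series with
weights `w` and `1` at `n` and `n + 1` differ by the difference of the `n`-th terms of the two
Lambert series, and they tend to `0`. -/
theorem binomSeries_id_zero {z : ℂ} (hz : z ≠ 0) :
    binomSeries z id 0 = (lambert z⁻¹ - serS X) * binomSeries z (fun _ => 1) 0 := by
  have hX : constantCoeff (X : ℂ⟦X⟧) = 0 := constantCoeff_X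
  have hH : ∀ n, binomSeries z (fun _ => 1) n * (binomSeries z (fun _ => 1) n)⁻¹ = 1 := fun n =>
    PowerSeries.mul_inv_cancel _ (by simp [constantCoeff_binomSeries_one])
  have hne : ∀ n, binomSeries z (fun _ => 1) n ≠ 0 := fun n h => by
    simpa [h] using hH n
  have hstep : ∀ n, binomSeries z id n * (binomSeries z (fun _ => 1) n)⁻¹ -
      binomSeries z id (n + 1) * (binomSeries z (fun _ => 1) (n + 1))⁻¹ =
      C z⁻¹ * X * X ^ n * (1 - C z⁻¹ * X * X ^ n)⁻¹ - X ^ (n + 2) * (1 - X ^ (n + 2))⁻¹ := by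
    intro n
    have e : (X : ℂ⟦X⟧) ^ (n + 2) = X * X * X ^ n := by ring
    have iy := one_sub_mul_inv_cancel (f := C z⁻¹ * X * X ^ n) (by simp)
    have iw := one_sub_mul_inv_cancel (f := (X : ℂ⟦X⟧) * X * X ^ n) (by simp)
    have h1 := binomSeries_one_succ hz n
    have h2 := binomSeries_id_succ hz n
    have i0 := hH n
    have i1 := hH (n + 1)
    have hn := hne n
    rw [e]
    generalize C z⁻¹ * X * X ^ n = Y at *
    generalize (X : ℂ⟦X⟧) * X * X ^ n = W at *
    generalize binomSeries z (fun _ => 1) n = h at *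
    generalize binomSeries z (fun _ => 1) (n + 1) = h' at *
    have k0 : ∃ r, r = binomSeries z id n * h⁻¹ := ⟨_, rfl⟩
    have k1 : ∃ r, r = binomSeries z id (n + 1) * h'⁻¹ := ⟨_, rfl⟩
    obtain ⟨r, hr⟩ := k0
    obtain ⟨r', hr'⟩ := k1
    rw [← hr, ← hr']
    have j0 : binomSeries z id n = r * h := by
      rw [hr]
      linear_combination -binomSeries z id n * i0
    have j1 : binomSeries z id (n + 1) = r' * h' := by
      rw [hr']
      linear_combination -binomSeries z id (n + 1) * i1
    rw [j0, j1] at h2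
    have h3 : (1 - W) * (1 - Y) * (r - r') = Y * (1 - W) - W * (1 - Y) := by
      refine mul_left_cancel₀ hn ?_
      linear_combination (1 - W) * h2 - (r' * (1 - W) - W) * h1
    linear_combination (1 - W)⁻¹ * (1 - Y)⁻¹ * h3 - (r - r') * (1 - W) * (1 - W)⁻¹ * iy -
      (r - r') * iw + Y * (1 - Y)⁻¹ * iw - W * (1 - W)⁻¹ * iy
  have hS : HasSum (fun n : ℕ => (X : ℂ⟦X⟧) ^ (n + 2) * (1 - X ^ (n + 2))⁻¹) (serS X) :=
    (summable_serS hX).hasSum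
  have h1 := ((hasSum_lambert z⁻¹).sub hS).tendsto_sum_nat
  simp_rw [← hstep, Finset.sum_range_sub'] at h1
  have h2 : Tendsto (fun n => binomSeries z id n * (binomSeries z (fun _ => 1) n)⁻¹) atTop
      (𝓝 0) := by
    refine tendsto_zero_of_X_pow_dvd fun n => ?_
    have := X_pow_dvd_binomSeries_sub z id n
    rw [id, Nat.cast_zero, sub_zero] at this
    exact ((pow_dvd_pow X n.le_succ).trans this).mul_right _
  have h3 := tendsto_nhds_unique (h2.const_sub _) h1
  rw [sub_zero] at h3
  rw [← h3]
  linear_combination -binomSeries z id 0 * hH 0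

/-- `∑ ω(π) z ^ crank(π) q ^ |π| = (q; q)_∞ / (z q, q / z; q)_∞ *
(∑_{n ≥ 1} z⁻¹ q ^ n / (1 - z⁻¹ q ^ n) - S(q))`. -/
theorem onesCrankSeries_eq {z : ℂ} (hz : z ≠ 0) :
    onesCrankSeries z = crankProduct z * (lambert z⁻¹ - serS X) := by
  have hX : constantCoeff (X : ℂ⟦X⟧) = 0 := constantCoeff_X
  have hp : ∀ w : ℂ, qPoch (C w * X) X * (qPoch (C w * X) X)⁻¹ = 1 := fun w =>
    PowerSeries.mul_inv_cancel _ (by simp [constantCoeff_qPoch])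
  rw [onesCrankSeries_eq_mul_binomSeries hz, binomSeries_id_zero hz, crankProduct,
    PowerSeries.mul_inv_rev, qPoch_eq_one_sub_mul X hX, ← binomSeries_one_zero_mul hz]
  linear_combination -(qPoch (C z * X) X)⁻¹ * (1 - X) * (lambert z⁻¹ - serS X) *
    binomSeries z (fun _ => 1) 0 * hp z⁻¹

/-! ### Lambert series at fifth roots of unity -/

theorem hasSum_serR {i : ℕ} (hi : 1 ≤ i) :
    HasSum (fun n : ℕ => (X : ℂ⟦X⟧) ^ ((n + 1) * i) * (1 - X ^ (5 * (n + 1)))⁻¹) (serR i X) :=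
  (summable_serR hi constantCoeff_X).hasSum

theorem lambert_eq {y : ℂ} (hy : y ^ 5 = 1) :
    lambert y = C y * serR 1 X + C y ^ 2 * serR 2 X + C y ^ 3 * serR 3 X + C y ^ 4 * serR 4 X +
      serR 5 X := by
  have hY : (C y ^ 5 : ℂ⟦X⟧) = 1 := by rw [← map_pow, hy, map_one]
  have h := (((((hasSum_serR (i := 1) (by norm_num)).mul_left (C y)).add
    ((hasSum_serR (i := 2) (by norm_num)).mul_left (C y ^ 2))).add
    ((hasSum_serR (i := 3) (by norm_num)).mul_left (C y ^ 3))).add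
    ((hasSum_serR (i := 4) (by norm_num)).mul_left (C y ^ 4))).add
    (hasSum_serR (i := 5) (by norm_num))
  refine (hasSum_lambert y).unique ((congrArg (fun F => HasSum F _) (funext fun n => ?_)).mpr h)
  have h1 := one_sub_mul_inv_cancel (f := C y * X * X ^ n) (by simp)
  have h5 := one_sub_mul_inv_cancel (f := (X : ℂ⟦X⟧) ^ (5 * (n + 1))) (by simp)
  have e : ∀ i, (X : ℂ⟦X⟧) ^ ((n + 1) * i) = (X * X ^ n) ^ i := fun i => by
    rw [pow_mul, pow_succ']
  rw [mul_comm 5 (n + 1)] at *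
  simp only [e, mul_assoc _ (X : ℂ⟦X⟧)] at *
  generalize (X : ℂ⟦X⟧) * X ^ n = x at *
  generalize (C y : ℂ⟦X⟧) = Y at *
  have h6 : Y * x * (1 - x ^ 5) =
      (1 - Y * x) * (Y * x + (Y * x) ^ 2 + (Y * x) ^ 3 + (Y * x) ^ 4 + x ^ 5) := by
    linear_combination x ^ 5 * hY
  linear_combination (1 - Y * x)⁻¹ * (1 - x ^ 5)⁻¹ * h6 - Y * x * (1 - Y * x)⁻¹ * h5 +
    (Y * x + (Y * x) ^ 2 + (Y * x) ^ 3 + (Y * x) ^ 4 + x ^ 5) * (1 - x ^ 5)⁻¹ * h1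

theorem lambert_one : lambert 1 = X * (1 - X)⁻¹ + serS X := by
  have h1 := (hasSum_nat_add_iff' 1).mpr (hasSum_lambert 1)
  have h2 : HasSum (fun n : ℕ => (X : ℂ⟦X⟧) ^ (n + 2) * (1 - X ^ (n + 2))⁻¹) (serS X) :=
    (summable_serS constantCoeff_X).hasSum
  have h3 := h1.unique ((congrArg (fun F => HasSum F _) (funext fun n => ?_)).mpr h2)
  · rw [Finset.sum_range_one, map_one, one_mul, pow_zero, mul_one] at h3
    linear_combination h3
  · rw [map_one, one_mul, show (X : ℂ⟦X⟧) * X ^ (n + 1) = X ^ (n + 2) by ring]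

theorem serT_eq_onesCrankSeries_one : 5 * serT X = onesCrankSeries 1 := by
  have hX : constantCoeff (X : ℂ⟦X⟧) = 0 := constantCoeff_X
  have hp : constantCoeff (qPoch (X : ℂ⟦X⟧) X) = 1 := constantCoeff_qPoch hX hX
  have i1 := one_sub_mul_inv_cancel hX
  have i2 := PowerSeries.mul_inv_cancel (qPoch (X : ℂ⟦X⟧) X) (by simp [hp])
  have hc : constantCoeff (5 : ℂ⟦X⟧) = 5 := map_ofNat _ 5
  have i3 := PowerSeries.mul_inv_cancel (5 * (1 - X) * qPoch (X : ℂ⟦X⟧) X) (by simp [hp, hc])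
  have i4 := PowerSeries.mul_inv_cancel (qPoch (X : ℂ⟦X⟧) X * qPoch X X) (by simp [hp])
  rw [onesCrankSeries_eq one_ne_zero, crankProduct, inv_one, lambert_one, map_one, one_mul, serT]
  generalize qPoch (X : ℂ⟦X⟧) X = e at *
  generalize (5 * (1 - X) * e)⁻¹ = j at *
  generalize (e * e)⁻¹ = k at *
  linear_combination X * ((1 - X)⁻¹ * e⁻¹ * i3 - 5 * j * i1 - 5 * j * (1 - X) * (1 - X)⁻¹ * i2) -
    X * (1 - X)⁻¹ * (e⁻¹ * i4 - e * k * i2)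

/-! ### Separation of the crank classes -/

/-- At a fifth root of unity only the crank modulo `5` matters. -/
theorem onesCrankSeries_eq_sum {z : ℂ} (hz : z ^ 5 = 1) :
    onesCrankSeries z = ∑ i : Fin 5, C z ^ (i : ℕ) * genMω i 5 := by
  ext n
  have h : ∀ k : ℤ, z ^ k = ∑ i : Fin 5, if k ≡ (i : ℕ) [ZMOD (5 : ℕ)] then z ^ (i : ℕ) else 0 := by
    intro k
    have hz0 : z ≠ 0 := by
      rintro rfl
      norm_num at hz
    have h1 : z ^ k = z ^ (k % 5).toNat := by
      have h5 : z ^ (5 : ℤ) = 1 := by exact_mod_cast hz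
      conv_lhs => rw [← Int.emod_add_mul_ediv k 5]
      rw [zpow_add₀ hz0, zpow_mul, h5, one_zpow, mul_one, ← zpow_natCast]
      congr 1
      omega
    have hk : (k % 5).toNat < 5 := by omega
    rw [h1, Finset.sum_eq_single ⟨(k % 5).toNat, hk⟩]
    · rw [if_pos]
      rw [Int.ModEq]
      push_cast
      omega
    · intro i _ hi
      rw [if_neg]
      intro hm
      apply hi
      rw [Int.ModEq] at hm
      push_cast at hm
      ext
      simp only
      omega
    · simp
  simp only [onesCrankSeries, genMω, map_sum, coeff_mk, ← map_pow, coeff_C_mul, Mω, h,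
    Finset.mul_sum, Nat.cast_sum]
  rw [Finset.sum_comm]
  refine Finset.sum_congr rfl fun i _ => ?_
  rw [Finset.sum_filter]
  refine Finset.sum_congr rfl fun π _ => ?_
  split_ifs
  · ring
  · ring

/-- Fourier inversion modulo `5`, as the invertibility of a Vandermonde matrix. -/
theorem eq_of_sum_root_pow_mul_eq {f g : Fin 5 → ℂ⟦X⟧}
    (h : ∀ z : ℂ, z ^ 5 = 1 → ∑ i : Fin 5, C z ^ (i : ℕ) * f i = ∑ i : Fin 5, C z ^ (i : ℕ) * g i) :
    f = g := by
  have hζ := Complex.isPrimitiveRoot_exp 5 (by norm_num)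
  set ζ := Complex.exp (2 * Real.pi * Complex.I / (5 : ℕ))
  rw [← sub_eq_zero]
  refine Matrix.eq_zero_of_forall_index_sum_pow_mul_eq_zero
    (f := fun j : Fin 5 => (C (ζ ^ (j : ℕ)) : ℂ⟦X⟧)) ?_ fun j => ?_
  · intro i j hij
    exact Fin.ext (hζ.pow_inj i.2 j.2 (C_injective hij))
  · have := h (ζ ^ (j : ℕ)) (by rw [← pow_mul, mul_comm, pow_mul, hζ.pow_eq_one, one_pow])
    simp only [Pi.sub_apply, mul_sub, Finset.sum_sub_distrib, this, sub_self]

/-- The five right-hand sides weighted by the powers of a primitive fifth root of unity `Z`: the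
5-dissected crank product times the Lambert series, `κ` being `1 / 5`
and `G` the series `C(q⁵)`. The two sides differ by a
multiple of the cyclotomic polynomial in `Z`. -/
theorem dissection_mul_lambert {K : Type*} [CommRing K] {Z κ : K}
    (hΦ : 1 + Z + Z ^ 2 + Z ^ 3 + Z ^ 4 = 0) (hκ : 5 * κ = 1)
    (x A B G D R₁ R₂ R₃ R₄ R₅ S T : K) :
    (A - x * (2 + Z ^ 2 + Z ^ 3) * B + x ^ 2 * (Z ^ 2 + Z ^ 3) * G - x ^ 3 * (Z + Z ^ 4) * D) *
      (Z ^ 4 * R₁ + Z ^ 3 * R₂ + Z ^ 2 * R₃ + Z * R₄ + R₅ - S) =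
      κ * (x ^ 3 * D * (-3 * R₁ + 2 * R₂ + 2 * R₃ - 3 * R₄ + 2 * R₅ - 2 * S))
        + κ * (x ^ 2 * G * (-2 * R₁ + 3 * R₂ + 3 * R₃ - 2 * R₄ - 2 * R₅ + 2 * S))
        + κ * (x * B * (4 * R₁ - R₂ - R₃ + 4 * R₄ - 6 * R₅ + 6 * S))
        + κ * (A * (-R₁ - R₂ - R₃ - R₄ + 4 * R₅ - 4 * S))
        + T +
      Z * (κ * (x ^ 3 * D * (2 * R₁ + 2 * R₂ - 3 * R₃ + 2 * R₄ - 3 * R₅ + 3 * S))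
        + κ * (x ^ 2 * G * (3 * R₁ + 3 * R₂ - 2 * R₃ - 2 * R₄ - 2 * R₅ + 2 * S))
        + κ * (x * B * (-R₁ - R₂ + 4 * R₃ - 6 * R₄ + 4 * R₅ - 4 * S))
        + κ * (A * (-R₁ - R₂ - R₃ + 4 * R₄ - R₅ + S))
        + T) +
      Z ^ 2 * (κ * (x ^ 3 * D * (2 * R₁ - 3 * R₂ + 2 * R₃ - 3 * R₄ + 2 * R₅ - 2 * S))
        + κ * (x ^ 2 * G * (3 * R₁ - 2 * R₂ - 2 * R₃ - 2 * R₄ + 3 * R₅ - 3 * S))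
        + κ * (x * B * (-R₁ + 4 * R₂ - 6 * R₃ + 4 * R₄ - R₅ + S))
        + κ * (A * (-R₁ - R₂ + 4 * R₃ - R₄ - R₅ + S))
        + T) +
      Z ^ 3 * (κ * (x ^ 3 * D * (-3 * R₁ + 2 * R₂ - 3 * R₃ + 2 * R₄ + 2 * R₅ - 2 * S))
        + κ * (x ^ 2 * G * (-2 * R₁ - 2 * R₂ - 2 * R₃ + 3 * R₄ + 3 * R₅ - 3 * S))
        + κ * (x * B * (4 * R₁ - 6 * R₂ + 4 * R₃ - R₄ - R₅ + S))
        + κ * (A * (-R₁ + 4 * R₂ - R₃ - R₄ - R₅ + S))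
        + T) +
      Z ^ 4 * (κ * (x ^ 3 * D * (2 * R₁ - 3 * R₂ + 2 * R₃ + 2 * R₄ - 3 * R₅ + 3 * S))
        + κ * (x ^ 2 * G * (-2 * R₁ - 2 * R₂ + 3 * R₃ + 3 * R₄ - 2 * R₅ + 2 * S))
        + κ * (x * B * (-6 * R₁ + 4 * R₂ - R₃ - R₄ + 4 * R₅ - 4 * S))
        + κ * (A * (4 * R₁ - R₂ - R₃ - R₄ - R₅ + S))
        + T) := by
  linear_combination -((A - x * (2 + Z ^ 2 + Z ^ 3) * B +
    x ^ 2 * (Z ^ 2 + Z ^ 3) * G - x ^ 3 * (Z + Z ^ 4) * D) *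
    (Z ^ 4 * R₁ + Z ^ 3 * R₂ + Z ^ 2 * R₃ + Z * R₄ + R₅ -
      S)) * hκ - (T + κ * (
    x ^ 3 * D * ((-3 + 5 * Z - 5 * Z ^ 3 + 5 * Z ^ 4) * R₁ + (2 - 5 * Z ^ 2 + 5 * Z ^ 3) * R₂ +
        (2 - 5 * Z + 5 * Z ^ 2) * R₃ + (-3 + 5 * Z) * R₄ + 2 * R₅ - 2 * S) +
    x ^ 2 * G * ((-2 + 5 * Z - 5 * Z ^ 3) * R₁ + (3 - 5 * Z ^ 2) * R₂ +
        (3 - 5 * Z) * R₃ - 2 * R₄ - 2 * R₅ + 2 * S) +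
    x * B * ((4 - 5 * Z + 5 * Z ^ 3) * R₁ + (-1 + 5 * Z ^ 2) * R₂ +
        (-1 + 5 * Z) * R₃ + 4 * R₄ + 4 * R₅ - 4 * S) +
    A * (-R₁ - R₂ - R₃ - R₄ - R₅ + S))) * hΦ

theorem genMω_eq :
    ![genMω 0 5, genMω 1 5, genMω 2 5, genMω 3 5, genMω 4 5] = ![
      (1 / 5 : ℂ) • (X ^ 3 * serD (X ^ 5) *
          (-3 * serR 1 X + 2 * serR 2 X + 2 * serR 3 X - 3 * serR 4 X + 2 * serR 5 X - 2 * serS X))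
        + (1 / 5 : ℂ) • (X ^ 2 * serC (X ^ 5) *
          (-2 * serR 1 X + 3 * serR 2 X + 3 * serR 3 X - 2 * serR 4 X - 2 * serR 5 X + 2 * serS X))
        + (1 / 5 : ℂ) • (X * serB (X ^ 5) *
          (4 * serR 1 X - serR 2 X - serR 3 X + 4 * serR 4 X - 6 * serR 5 X + 6 * serS X))
        + (1 / 5 : ℂ) • (serA (X ^ 5) *
          (-serR 1 X - serR 2 X - serR 3 X - serR 4 X + 4 * serR 5 X - 4 * serS X))
        + serT X,
      (1 / 5 : ℂ) • (X ^ 3 * serD (X ^ 5) *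
          (2 * serR 1 X + 2 * serR 2 X - 3 * serR 3 X + 2 * serR 4 X - 3 * serR 5 X + 3 * serS X))
        + (1 / 5 : ℂ) • (X ^ 2 * serC (X ^ 5) *
          (3 * serR 1 X + 3 * serR 2 X - 2 * serR 3 X - 2 * serR 4 X - 2 * serR 5 X + 2 * serS X))
        + (1 / 5 : ℂ) • (X * serB (X ^ 5) *
          (-serR 1 X - serR 2 X + 4 * serR 3 X - 6 * serR 4 X + 4 * serR 5 X - 4 * serS X))
        + (1 / 5 : ℂ) • (serA (X ^ 5) *
          (-serR 1 X - serR 2 X - serR 3 X + 4 * serR 4 X - serR 5 X + serS X))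
        + serT X,
      (1 / 5 : ℂ) • (X ^ 3 * serD (X ^ 5) *
          (2 * serR 1 X - 3 * serR 2 X + 2 * serR 3 X - 3 * serR 4 X + 2 * serR 5 X - 2 * serS X))
        + (1 / 5 : ℂ) • (X ^ 2 * serC (X ^ 5) *
          (3 * serR 1 X - 2 * serR 2 X - 2 * serR 3 X - 2 * serR 4 X + 3 * serR 5 X - 3 * serS X))
        + (1 / 5 : ℂ) • (X * serB (X ^ 5) *
          (-serR 1 X + 4 * serR 2 X - 6 * serR 3 X + 4 * serR 4 X - serR 5 X + serS X))
        + (1 / 5 : ℂ) • (serA (X ^ 5) *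
          (-serR 1 X - serR 2 X + 4 * serR 3 X - serR 4 X - serR 5 X + serS X))
        + serT X,
      (1 / 5 : ℂ) • (X ^ 3 * serD (X ^ 5) *
          (-3 * serR 1 X + 2 * serR 2 X - 3 * serR 3 X + 2 * serR 4 X + 2 * serR 5 X - 2 * serS X))
        + (1 / 5 : ℂ) • (X ^ 2 * serC (X ^ 5) *
          (-2 * serR 1 X - 2 * serR 2 X - 2 * serR 3 X + 3 * serR 4 X + 3 * serR 5 X - 3 * serS X))
        + (1 / 5 : ℂ) • (X * serB (X ^ 5) *
          (4 * serR 1 X - 6 * serR 2 X + 4 * serR 3 X - serR 4 X - serR 5 X + serS X))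
        + (1 / 5 : ℂ) • (serA (X ^ 5) *
          (-serR 1 X + 4 * serR 2 X - serR 3 X - serR 4 X - serR 5 X + serS X))
        + serT X,
      (1 / 5 : ℂ) • (X ^ 3 * serD (X ^ 5) *
          (2 * serR 1 X - 3 * serR 2 X + 2 * serR 3 X + 2 * serR 4 X - 3 * serR 5 X + 3 * serS X))
        + (1 / 5 : ℂ) • (X ^ 2 * serC (X ^ 5) *
          (-2 * serR 1 X - 2 * serR 2 X + 3 * serR 3 X + 3 * serR 4 X - 2 * serR 5 X + 2 * serS X))
        + (1 / 5 : ℂ) • (X * serB (X ^ 5) *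
          (-6 * serR 1 X + 4 * serR 2 X - serR 3 X - serR 4 X + 4 * serR 5 X - 4 * serS X))
        + (1 / 5 : ℂ) • (serA (X ^ 5) *
          (4 * serR 1 X - serR 2 X - serR 3 X - serR 4 X - serR 5 X + serS X))
        + serT X] := by
  refine eq_of_sum_root_pow_mul_eq fun z hz => ?_
  have h := onesCrankSeries_eq_sum hz
  have hκ : (5 * C (1 / 5) : ℂ⟦X⟧) = 1 := by
    rw [show (5 : ℂ⟦X⟧) = C 5 from (map_ofNat C 5).symm, ← map_mul]
    norm_num
  simp only [Fin.sum_univ_five] at h ⊢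
  simp only [Fin.coe_ofNat_eq_mod, Nat.reduceMod, pow_zero, pow_one, one_mul, Nat.cast_zero,
    Nat.cast_one, Nat.cast_ofNat] at h ⊢
  simp only [Matrix.cons_val, smul_eq_C_mul]
  refine Eq.trans h.symm ?_
  generalize (C (1 / 5) : ℂ⟦X⟧) = κ at *
  -- at `z = 1` the coefficients of each product sum to `0`, and only `5 T` is left
  by_cases hz1 : z = 1
  · subst hz1
    rw [← serT_eq_onesCrankSeries_one, map_one]
    simp only [one_pow, one_mul]
    ring
  · have hz0 : z ≠ 0 := by
      rintro rfl
      norm_num at hz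
    have hinv : z⁻¹ = z ^ 4 := inv_eq_of_mul_eq_one_right (by linear_combination hz)
    have hz4 : (z ^ 4) ^ 5 = 1 := by rw [← pow_mul, pow_mul', hz, one_pow]
    have hΦ : 1 + z + z ^ 2 + z ^ 3 + z ^ 4 = 0 :=
      mul_left_cancel₀ (sub_ne_zero.mpr hz1) (by linear_combination hz)
    replace hΦ := congrArg (C (R := ℂ)) hΦ
    have hZ := congrArg (C (R := ℂ)) hz
    simp only [map_add, map_pow, map_one, map_zero] at hΦ hZ
    rw [onesCrankSeries_eq hz0, crankProduct_dissection hz hz1, hinv, lambert_eq hz4, map_pow]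
    generalize (C z : ℂ⟦X⟧) = Z at *
    have p8 : (Z ^ 4) ^ 2 = Z ^ 3 := by linear_combination Z ^ 3 * hZ
    have p12 : (Z ^ 4) ^ 3 = Z ^ 2 := by linear_combination (Z ^ 7 + Z ^ 2) * hZ
    have p16 : (Z ^ 4) ^ 4 = Z := by linear_combination (Z ^ 11 + Z ^ 6 + Z) * hZ
    rw [p8, p12, p16]
    exact dissection_mul_lambert hΦ hκ _ _ _ _ _ _ _ _ _ _ _ _

theorem theorem3p1 :
    (genMω 0 5 =
        (1 / 5 : ℂ) • (X ^ 3 * serD (X ^ 5) *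
          (-3 * serR 1 X + 2 * serR 2 X + 2 * serR 3 X - 3 * serR 4 X + 2 * serR 5 X - 2 * serS X))
        + (1 / 5 : ℂ) • (X ^ 2 * serC (X ^ 5) *
          (-2 * serR 1 X + 3 * serR 2 X + 3 * serR 3 X - 2 * serR 4 X - 2 * serR 5 X + 2 * serS X))
        + (1 / 5 : ℂ) • (X * serB (X ^ 5) *
          (4 * serR 1 X - serR 2 X - serR 3 X + 4 * serR 4 X - 6 * serR 5 X + 6 * serS X))
        + (1 / 5 : ℂ) • (serA (X ^ 5) *
          (-serR 1 X - serR 2 X - serR 3 X - serR 4 X + 4 * serR 5 X - 4 * serS X))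
        + serT X) ∧
    (genMω 1 5 =
        (1 / 5 : ℂ) • (X ^ 3 * serD (X ^ 5) *
          (2 * serR 1 X + 2 * serR 2 X - 3 * serR 3 X + 2 * serR 4 X - 3 * serR 5 X + 3 * serS X))
        + (1 / 5 : ℂ) • (X ^ 2 * serC (X ^ 5) *
          (3 * serR 1 X + 3 * serR 2 X - 2 * serR 3 X - 2 * serR 4 X - 2 * serR 5 X + 2 * serS X))
        + (1 / 5 : ℂ) • (X * serB (X ^ 5) *
          (-serR 1 X - serR 2 X + 4 * serR 3 X - 6 * serR 4 X + 4 * serR 5 X - 4 * serS X))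
        + (1 / 5 : ℂ) • (serA (X ^ 5) *
          (-serR 1 X - serR 2 X - serR 3 X + 4 * serR 4 X - serR 5 X + serS X))
        + serT X) ∧
    (genMω 2 5 =
        (1 / 5 : ℂ) • (X ^ 3 * serD (X ^ 5) *
          (2 * serR 1 X - 3 * serR 2 X + 2 * serR 3 X - 3 * serR 4 X + 2 * serR 5 X - 2 * serS X))
        + (1 / 5 : ℂ) • (X ^ 2 * serC (X ^ 5) *
          (3 * serR 1 X - 2 * serR 2 X - 2 * serR 3 X - 2 * serR 4 X + 3 * serR 5 X - 3 * serS X))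
        + (1 / 5 : ℂ) • (X * serB (X ^ 5) *
          (-serR 1 X + 4 * serR 2 X - 6 * serR 3 X + 4 * serR 4 X - serR 5 X + serS X))
        + (1 / 5 : ℂ) • (serA (X ^ 5) *
          (-serR 1 X - serR 2 X + 4 * serR 3 X - serR 4 X - serR 5 X + serS X))
        + serT X) ∧
    (genMω 3 5 =
        (1 / 5 : ℂ) • (X ^ 3 * serD (X ^ 5) *
          (-3 * serR 1 X + 2 * serR 2 X - 3 * serR 3 X + 2 * serR 4 X + 2 * serR 5 X - 2 * serS X))
        + (1 / 5 : ℂ) • (X ^ 2 * serC (X ^ 5) *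
          (-2 * serR 1 X - 2 * serR 2 X - 2 * serR 3 X + 3 * serR 4 X + 3 * serR 5 X - 3 * serS X))
        + (1 / 5 : ℂ) • (X * serB (X ^ 5) *
          (4 * serR 1 X - 6 * serR 2 X + 4 * serR 3 X - serR 4 X - serR 5 X + serS X))
        + (1 / 5 : ℂ) • (serA (X ^ 5) *
          (-serR 1 X + 4 * serR 2 X - serR 3 X - serR 4 X - serR 5 X + serS X))
        + serT X) ∧
    (genMω 4 5 =
        (1 / 5 : ℂ) • (X ^ 3 * serD (X ^ 5) *
          (2 * serR 1 X - 3 * serR 2 X + 2 * serR 3 X + 2 * serR 4 X - 3 * serR 5 X + 3 * serS X))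
        + (1 / 5 : ℂ) • (X ^ 2 * serC (X ^ 5) *
          (-2 * serR 1 X - 2 * serR 2 X + 3 * serR 3 X + 3 * serR 4 X - 2 * serR 5 X + 2 * serS X))
        + (1 / 5 : ℂ) • (X * serB (X ^ 5) *
          (-6 * serR 1 X + 4 * serR 2 X - serR 3 X - serR 4 X + 4 * serR 5 X - 4 * serS X))
        + (1 / 5 : ℂ) • (serA (X ^ 5) *
          (4 * serR 1 X - serR 2 X - serR 3 X - serR 4 X - serR 5 X + serS X))
        + serT X) := by
  have h := genMω_eq
  exact ⟨congrFun h 0, congrFun h 1, congrFun h 2, congrFun h 3, congrFun h 4⟩
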